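/- Let $n\ge 1$ and let $\mathbb B_n$ be the open unit ball of $\mathbb C^n$, with $\langle z,w\rangle=\sum_{j=1}^n z_j\overline{w_j}$ and $|z|=\sqrt{\langle z,z\rangle}$. For real $a>-1$ and $b>-n$ let $\mu_{a,b}$ be the probability measure on $\mathbb B_n$ given by $$d\mu_{a,b}(z)=\frac{(n-1)!}{\pi^n\,\beta(a+1,b+n)}\,|z|^{2b}(1-|z|^2)^a\,d\lambda_n(z),$$ where $\lambda_n$ is the Lebesgue measure on $\mathbb C^n$ and $\beta(s,t)=\Gamma(s)\Gamma(t)/\Gamma(s+t)$. Let $$\mathcal K_{a,b}(\xi)={}_2F_1(n,\,a+b+n+1;\,b+n;\,\xi)=\sum_{k\ge 0}\frac{(n)_k\,(a+b+n+1)_k}{(b+n)_k}\,\frac{\xi^k}{k!},\qquad |\xi|<1,$$ where $(x)_k=x(x+1)\cdots(x+k-1)$, and define the Berezin transform of a measurable function $f:\mathbb B_n\to\mathbb C$ by $$\mathbf B_{a,b}f(z)=\int_{\mathbb B_n} f(w)\,\frac{|\mathcal K_{a,b}(\langle w,z\rangle)|^2}{\mathcal K_{a,b}(|z|^2)}\,d\mu_{a,b}(w).$$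 **Theorem 3.2.** Let $a,c>-1$, $b,d>-n$ and $1\le p<\infty$. Then $\mathbf B_{a,b}$ is a bounded operator from $L^p(\mathbb B_n,d\mu_{c,d})$ to itself (that is, there is a constant $C$ such that for every $f\in L^p(\mathbb B_n,d\mu_{c,d})$ the integral defining $\mathbf B_{a,b}f(z)$ converges absolutely for almost every $z$, and $\mathbf B_{a,b}f\in L^p(\mathbb B_n,d\mu_{c,d})$ with $\|\mathbf B_{a,b}f\|_{L^p(\mu_{c,d})}\le C\|f\|_{L^p(\mu_{c,d})}$) if and only if $$c+1<p(a+1)\qquad\text{and}\qquad\begin{cases} d+n<p(b+n) & \text{if } p>1,\\ d\le b & \text{if } p=1.\end{cases}$$ -/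

import Mathlib

namespace ModifiedBergman

open MeasureTheory

/-- The measure `dμ_{a,b}` on the unit ball `𝔹ₙ` of `ℂⁿ` (seen as a measure on `ℂⁿ` that is
concentrated on the open unit ball):
`dμ_{a,b}(z) = (n-1)! / (πⁿ β(a+1, b+n)) * |z|^(2b) * (1-|z|²)^a dλₙ(z)`.
Here `volume` is Lebesgue measure on `ℂⁿ = ℝ²ⁿ` and
`ProbabilityTheory.beta s t = Γ(s) Γ(t) / Γ(s+t)` is the beta function. -/
noncomputable def mu (n : ℕ) (a b : ℝ) : Measure (EuclideanSpace ℂ (Fin n)) :=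
  (volume.restrict (Metric.ball (0 : EuclideanSpace ℂ (Fin n)) 1)).withDensity fun z =>
    ENNReal.ofReal
      (((n - 1).factorial : ℝ) / (Real.pi ^ n * ProbabilityTheory.beta (a + 1) (b + n)) *
        (‖z‖ ^ (2 * b) * (1 - ‖z‖ ^ 2) ^ a))

/-- The function `𝒦_{a,b}(ξ) = ₂F₁(n, a+b+n+1; b+n; ξ)` on the unit disk; the reproducing kernel of
the weighted Bergman space `𝒜²_{a,b}(𝔹ₙ)` is `(w, z) ↦ 𝒦_{a,b}(⟨w, z⟩)`. -/
noncomputable def kernel (n : ℕ) (a b : ℝ) (ξ : ℂ) : ℂ :=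
  ₂F₁ (n : ℂ) ((a + b + n + 1 : ℝ) : ℂ) ((b + n : ℝ) : ℂ) ξ

/-- The integrand `w ↦ f(w) |𝒦_{a,b}(⟨w, z⟩)|² / 𝒦_{a,b}(|z|²)` of the Berezin transform at `z`.
Mathlib's inner product is conjugate-linear in its first argument, so that
`⟨w, z⟩ = ∑ⱼ wⱼ * conj zⱼ` is `inner ℂ z w`. -/
noncomputable def berezinIntegrand (n : ℕ) (a b : ℝ) (f : EuclideanSpace ℂ (Fin n) → ℂ)
    (z w : EuclideanSpace ℂ (Fin n)) : ℂ :=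
  f w * (((‖kernel n a b (inner ℂ z w)‖ ^ 2 : ℝ) : ℂ) / kernel n a b ((‖z‖ ^ 2 : ℝ) : ℂ))

/-- The Berezin transform
`𝐁_{a,b} f(z) = ∫ f(w) |𝒦_{a,b}(⟨w, z⟩)|² / 𝒦_{a,b}(|z|²) dμ_{a,b}(w)`. -/
noncomputable def berezin (n : ℕ) (a b : ℝ) (f : EuclideanSpace ℂ (Fin n) → ℂ)
    (z : EuclideanSpace ℂ (Fin n)) : ℂ :=
  ∫ w, berezinIntegrand n a b f z w ∂(mu n a b)

/-- `𝐁_{a,b}` is a bounded operator from `L^p(𝔹ₙ, dμ_{c,d})` to itself: for every `f` in this space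
the integral that defines `𝐁_{a,b} f(z)` converges absolutely for almost every `z ∈ 𝔹ₙ`, the
function `𝐁_{a,b} f` belongs to the space, and its norm is at most `C` times that of `f`, with `C`
independent of `f`. -/
def BerezinBounded (n : ℕ) (a b c d p : ℝ) : Prop :=
  ∃ C : NNReal, ∀ f : EuclideanSpace ℂ (Fin n) → ℂ, MemLp f (ENNReal.ofReal p) (mu n c d) →
    (∀ᵐ z ∂(mu n c d), Integrable (berezinIntegrand n a b f z) (mu n a b)) ∧
    MemLp (berezin n a b f) (ENNReal.ofReal p) (mu n c d) ∧
    eLpNorm (berezin n a b f) (ENNReal.ofReal p) (mu n c d) ≤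
      C * eLpNorm f (ENNReal.ofReal p) (mu n c d)

end ModifiedBergman

namespace ModifiedBergman

open MeasureTheory Filter Asymptotics Topology Set
open scoped ENNReal NNReal

/-! ### Asymptotics of quotients of Gamma functions -/

/-! Integrals of `|𝒦(⟨w,z⟩)|²` against a radial weight `|w|^(2s) (1-|w|²)^t` are computed exactly.
Averaging over the rotations `w ↦ e^(iθ) w` removes the cross terms of the double power series. The
sphere moments of `|⟨w,z⟩|` are constant multiples of `k!/Γ(k+n) |z|^(2k)`, and the radial integrals
are beta functions (`exists_lintegral_sqNorm_inner_mul_wt`). The resulting coefficients are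
comparable to `(k+1)^(n+2a-t)`, so comparison with the binomial series bounds the integral by a
multiple of `(1-|z|²)^(-(n+1+2a-t))` when `n+1+2a-t > 0`. Likewise `𝒦(x)` is comparable to
`(1-x)^(-(n+a+1))` on `[0,1)`.

Sufficiency is Schur's test with `h(w) = |w|^(-2v/p) (1-|w|²)^(-u/p)`. The boundary condition on `c`
leaves an admissible `u`, and the condition on `d` at the origin leaves an admissible `v`. For `p =
1` the column estimate alone is enough (`exists_lintegral_bkernel_rpow_le`).

Necessity tests the operator on the weights `wt s t`. The `k = 0` term of the series already gives
`β(n+b+s, a+t+1)^p ≤ C β(n+d+ps, c+pt+1)` with `C` independent of `s` and `t`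
(`BerezinBounded.exists_beta_rpow_le`). As `a+t+1` or `n+b+s` tends to `0`, the simple pole of the
beta function contradicts this inequality, except when `p = 1` and the exponents match. The case `p
= 1`, `c = a` needs the whole series: boundedness would make the harmonic series converge
(`not_berezinBounded_one`). For `p = 1`, `d = b` there is no obstruction. -/

theorem differentiableAt_Gamma_of_pos {x : ℝ} (hx : 0 < x) : DifferentiableAt ℝ Real.Gamma x :=
  Real.differentiableAt_Gamma fun m => by
    have : (0 : ℝ) ≤ m := m.cast_nonneg
    linarith

/-- Two positive sequences with a positive limit of the quotient are comparable. -/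
theorem isTheta_top_of_tendsto_div {u v : ℕ → ℝ} {L : ℝ} (hu : ∀ k, 0 < u k) (hv : ∀ k, 0 < v k)
    (hL : 0 < L) (h : Tendsto (fun k => u k / v k) atTop (𝓝 L)) : u =Θ[⊤] v := by
  have h1 : u =Θ[atTop] v := (isTheta_of_div_tendsto_nhds_ne_zero h hL.ne').symm
  constructor
  · exact isBigO_top.2 ((isBigO_nat_atTop_iff (fun k hk => absurd hk (hv k).ne')).1 h1.1)
  · exact isBigO_top.2 ((isBigO_nat_atTop_iff (fun k hk => absurd hk (hu k).ne')).1 h1.2)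

theorem ascPochhammer_eval_eq_Gamma {x : ℝ} (hx : 0 < x) (k : ℕ) :
    (ascPochhammer ℝ k).eval x = Real.Gamma (k + x) / Real.Gamma x := by
  induction k with
  | zero => simp [(Real.Gamma_pos_of_pos hx).ne']
  | succ k ih =>
    rw [ascPochhammer_succ_eval, ih]
    have : Real.Gamma ((k + 1 : ℕ) + x) = (k + x) * Real.Gamma (k + x) := by
      rw [← Real.Gamma_add_one (by positivity)]; congr 1; push_cast; ring
    rw [this]; ring

theorem prod_range_add_eq_Gamma {x : ℝ} (hx : 0 < x) (k : ℕ) :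
    ∏ j ∈ Finset.range k, (x + j) = Real.Gamma (k + x) / Real.Gamma x := by
  induction k with
  | zero => simp [(Real.Gamma_pos_of_pos hx).ne']
  | succ k ih =>
    rw [Finset.prod_range_succ, ih]
    have : Real.Gamma ((k + 1 : ℕ) + x) = (k + x) * Real.Gamma (k + x) := by
      rw [← Real.Gamma_add_one (by positivity)]; congr 1; push_cast; ring
    rw [this]; ring

/-- The quotient is `Γ(x) / GammaSeq x k` times two factors tending to `1`, so it tends to `1` by
Euler's limit formula. The filter `⊤` makes the comparison uniform in all `k`, and the base `k + 1`
keeps the power positive at `k = 0`. -/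
theorem Gamma_natCast_add_isTheta {x : ℝ} (hx : 0 < x) :
    (fun k : ℕ => Real.Gamma (k + x)) =Θ[⊤]
      fun k => (k.factorial : ℝ) * ((k : ℝ) + 1) ^ (x - 1) := by
  refine isTheta_top_of_tendsto_div (L := 1)
    (fun k => Real.Gamma_pos_of_pos (by positivity)) (fun k => by positivity) one_pos ?_
  have h1 := Real.GammaSeq_tendsto_Gamma x
  have h2 : Tendsto (fun k : ℕ => Real.Gamma x / Real.GammaSeq x k) atTop (𝓝 1) := by
    have := h1.inv₀ (Real.Gamma_pos_of_pos hx).ne' |>.const_mul (Real.Gamma x)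
    simpa [div_eq_mul_inv, (Real.Gamma_pos_of_pos hx).ne'] using this
  have h3 : Tendsto (fun k : ℕ => ((k : ℝ) / (k + 1)) ^ (x - 1)) atTop (𝓝 1) := by
    have := (tendsto_natCast_div_add_atTop (1 : ℝ)).rpow_const (p := x - 1) (Or.inl one_ne_zero)
    simpa using this
  have h4 : Tendsto (fun k : ℕ => (k : ℝ) / (k + x)) atTop (𝓝 1) := tendsto_natCast_div_add_atTop x
  have h5 := (h2.mul h3).mul h4
  simp only [mul_one] at h5
  refine h5.congr' ?_
  filter_upwards [eventually_gt_atTop 0] with k hk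
  have hk' : (0 : ℝ) < k := by exact_mod_cast hk
  have hG : Real.Gamma ((k + 1 : ℕ) + x) = (k + x) * Real.Gamma (k + x) := by
    rw [← Real.Gamma_add_one (by positivity)]; congr 1; push_cast; ring
  have hGp := Real.Gamma_pos_of_pos hx
  have hGk := Real.Gamma_pos_of_pos (by positivity : 0 < (k : ℝ) + x)
  rw [Real.GammaSeq, prod_range_add_eq_Gamma hx, hG, Real.div_rpow hk'.le (by positivity),
    Real.rpow_sub_one hk'.ne']
  have := Real.rpow_pos_of_pos hk' x
  have := Real.rpow_pos_of_pos (by positivity : (0 : ℝ) < k + 1) (x - 1)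
  have := Nat.factorial_pos k
  field_simp

theorem beta_natCast_add_isTheta {x t : ℝ} (hx : 0 < x) (ht : 0 < t) :
    (fun k : ℕ => ProbabilityTheory.beta (k + x) t) =Θ[⊤] fun k => ((k : ℝ) + 1) ^ (-t) := by
  have h := ((Gamma_natCast_add_isTheta hx).div (Gamma_natCast_add_isTheta (add_pos hx ht)))
  have h2 := (isTheta_const_mul_left (Real.Gamma_pos_of_pos ht).ne').2 h
  refine (EventuallyEq.trans_isTheta (.of_eq (funext fun k => ?_)) h2).trans_eventuallyEq
    (.of_eq (funext fun k => ?_))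
  · rw [ProbabilityTheory.beta, add_assoc]; ring
  · have : (0 : ℝ) < (k.factorial : ℝ) := by positivity
    have hk : (0 : ℝ) < (k : ℝ) + 1 := by positivity
    rw [mul_div_mul_left _ _ this.ne', ← Real.rpow_sub hk]
    congr 1; ring

/-- The binomial series with Gamma coefficients. -/
theorem hasSum_Gamma_mul_pow {s x : ℝ} (hs : 0 < s) (hx0 : 0 ≤ x) (hx1 : x < 1) :
    HasSum (fun k : ℕ => Real.Gamma (k + s) / (Real.Gamma s * k.factorial) * x ^ k)
      ((1 - x) ^ (-s)) := by
  have h := (Real.one_div_one_sub_rpow_hasFPowerSeriesOnBall_zero s).hasSum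
    (y := x) (by simpa [enorm_eq_nnnorm, ← NNReal.coe_lt_one, abs_of_nonneg hx0] using hx1)
  simp only [FormalMultilinearSeries.ofScalars_apply_eq, smul_eq_mul, zero_add] at h
  rw [Real.rpow_neg (by linarith), ← one_div]
  have e : ∀ k : ℕ, Ring.choose (s + k - 1) k =
      Real.Gamma (k + s) / (Real.Gamma s * k.factorial) := fun k => by
    rw [← Ring.multichoose_eq]
    have h1 := Ring.factorial_nsmul_multichoose_eq_ascPochhammer s k
    rw [Polynomial.ascPochhammer_smeval_eq_eval, ascPochhammer_eval_eq_Gamma hs, nsmul_eq_mul] at h1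
    have h2 : (k.factorial : ℝ) ≠ 0 := by positivity
    rw [← div_div, ← h1]
    field_simp
  simpa only [e] using h

theorem exists_bounds_of_isTheta_top {ι : Type*} {u v : ι → ℝ} (hu : ∀ k, 0 < u k)
    (hv : ∀ k, 0 < v k) (h : u =Θ[⊤] v) :
    ∃ m M : ℝ, 0 < m ∧ 0 < M ∧ ∀ k, m * v k ≤ u k ∧ u k ≤ M * v k := by
  obtain ⟨C, hC⟩ := isBigO_top.1 h.1
  obtain ⟨D, hD⟩ := isBigO_top.1 h.2
  simp only [Real.norm_of_nonneg (hu _).le, Real.norm_of_nonneg (hv _).le] at hC hD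
  refine ⟨(max D 1)⁻¹, max C 1, by positivity, by positivity, fun k => ⟨?_, ?_⟩⟩
  · rw [inv_mul_le_iff₀ (by positivity)]
    exact (hD k).trans (mul_le_mul_of_nonneg_right (le_max_left _ _) (hu k).le)
  · exact (hC k).trans (mul_le_mul_of_nonneg_right (le_max_left _ _) (hv k).le)

theorem Gamma_div_factorial_isTheta {s : ℝ} (hs : 0 < s) :
    (fun k : ℕ => Real.Gamma (k + s) / (Real.Gamma s * k.factorial)) =Θ[⊤]
      fun k => ((k : ℝ) + 1) ^ (s - 1) := by
  have h := (Gamma_natCast_add_isTheta hs).div (isTheta_refl (fun k : ℕ => (k.factorial : ℝ)) ⊤)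
  have h2 := (isTheta_const_mul_left (inv_ne_zero (Real.Gamma_pos_of_pos hs).ne')).2 h
  refine (EventuallyEq.trans_isTheta (.of_eq (funext fun k => ?_)) h2).trans_eventuallyEq
    (.of_eq (funext fun k => ?_))
  · rw [← div_div, div_right_comm, div_eq_inv_mul]
  · have : (k.factorial : ℝ) ≠ 0 := by positivity
    field_simp

/-- A power series with nonnegative coefficients of growth at most `k ^ (s - 1)` is
`O((1 - x) ^ (-s))` on `[0, 1)`. -/
theorem exists_tsum_mul_pow_le {u : ℕ → ℝ} {s : ℝ} (hs : 0 < s) (hu : ∀ k, 0 ≤ u k)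
    (h : u =O[⊤] fun k => ((k : ℝ) + 1) ^ (s - 1)) :
    ∃ M : ℝ, 0 < M ∧ ∀ x : ℝ, 0 ≤ x → x < 1 → Summable (fun k => u k * x ^ k) ∧
      ∑' k, u k * x ^ k ≤ M * (1 - x) ^ (-s) := by
  -- The binomial series of `(1 - x) ^ (-s)` has coefficients of size `(k+1) ^ (s-1)`, so it
  -- dominates termwise.
  obtain ⟨C, hC⟩ := isBigO_top.1 (h.trans (Gamma_div_factorial_isTheta hs).2)
  have hpos : ∀ k : ℕ, 0 < Real.Gamma (k + s) / (Real.Gamma s * k.factorial) := fun k => by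
    have := Real.Gamma_pos_of_pos hs
    have := Real.Gamma_pos_of_pos (by positivity : 0 < (k : ℝ) + s)
    positivity
  simp only [Real.norm_of_nonneg (hu _), Real.norm_of_nonneg (hpos _).le] at hC
  refine ⟨max C 1, by positivity, fun x hx0 hx1 => ?_⟩
  have hs' := (hasSum_Gamma_mul_pow hs hx0 hx1).mul_left (max C 1)
  have hle : ∀ k : ℕ, u k * x ^ k ≤
      max C 1 * (Real.Gamma (k + s) / (Real.Gamma s * k.factorial) * x ^ k) := fun k => by
    rw [← mul_assoc]
    refine mul_le_mul_of_nonneg_right ((hC k).trans ?_) (pow_nonneg hx0 k)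
    exact mul_le_mul_of_nonneg_right (le_max_left _ _) (hpos k).le
  have hsum : Summable (fun k => u k * x ^ k) :=
    Summable.of_nonneg_of_le (fun k => mul_nonneg (hu k) (pow_nonneg hx0 k)) hle hs'.summable
  exact ⟨hsum, hasSum_le hle hsum.hasSum hs'⟩

/-- The binomial comparison in the other direction; the upper bound enters only to give summability.
-/
theorem exists_le_tsum_mul_pow {u : ℕ → ℝ} {s : ℝ} (hs : 0 < s) (hu : ∀ k, 0 ≤ u k)
    (h : u =Θ[⊤] fun k => ((k : ℝ) + 1) ^ (s - 1)) :
    ∃ m : ℝ, 0 < m ∧ ∀ x : ℝ, 0 ≤ x → x < 1 → m * (1 - x) ^ (-s) ≤ ∑' k, u k * x ^ k := by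
  obtain ⟨C, hC⟩ := isBigO_top.1 ((Gamma_div_factorial_isTheta hs).1.trans h.2)
  obtain ⟨M, -, hM⟩ := exists_tsum_mul_pow_le hs hu h.1
  have hpos : ∀ k : ℕ, 0 < Real.Gamma (k + s) / (Real.Gamma s * k.factorial) := fun k => by
    have := Real.Gamma_pos_of_pos hs
    have := Real.Gamma_pos_of_pos (by positivity : 0 < (k : ℝ) + s)
    positivity
  simp only [Real.norm_of_nonneg (hu _), Real.norm_of_nonneg (hpos _).le] at hC
  refine ⟨(max C 1)⁻¹, by positivity, fun x hx0 hx1 => ?_⟩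
  rw [inv_mul_le_iff₀ (by positivity)]
  refine hasSum_le (fun k => ?_) (hasSum_Gamma_mul_pow hs hx0 hx1)
    ((hM x hx0 hx1).1.hasSum.mul_left (max C 1))
  rw [← mul_assoc]
  refine mul_le_mul_of_nonneg_right ((hC k).trans ?_) (pow_nonneg hx0 k)
  exact mul_le_mul_of_nonneg_right (le_max_left _ _) (hu k)

/-- `y * beta x y → 1` as `y → 0`. -/
theorem tendsto_mul_beta {x : ℝ} (hx : 0 < x) :
    Tendsto (fun y => y * ProbabilityTheory.beta x y) (𝓝[>] 0) (𝓝 1) := by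
  have h0 : ContinuousAt Real.Gamma x :=
    (differentiableAt_Gamma_of_pos hx).continuousAt
  have h1 : ContinuousAt Real.Gamma 1 :=
    (differentiableAt_Gamma_of_pos one_pos).continuousAt
  have hx' := (Real.Gamma_pos_of_pos hx).ne'
  have h2 : Tendsto (fun y : ℝ => Real.Gamma x * Real.Gamma (y + 1) / Real.Gamma (x + y)) (𝓝 0)
      (𝓝 (Real.Gamma x * Real.Gamma 1 / Real.Gamma x)) := by
    refine Tendsto.div (Tendsto.const_mul _ ?_) ?_ hx'
    · exact h1.tendsto.comp (Continuous.tendsto' (by fun_prop) 0 1 (by simp))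
    · exact h0.tendsto.comp (Continuous.tendsto' (by fun_prop) 0 x (by simp))
  rw [Real.Gamma_one, mul_one, div_self hx'] at h2
  refine (h2.mono_left nhdsWithin_le_nhds).congr' ?_
  filter_upwards [self_mem_nhdsWithin] with y hy
  rw [Real.Gamma_add_one (ne_of_gt hy), ProbabilityTheory.beta]; ring

theorem continuousAt_beta {x y : ℝ} (hx : 0 < x) (hy : 0 < y) :
    ContinuousAt (fun t => ProbabilityTheory.beta x t) y := by
  have h0 := (differentiableAt_Gamma_of_pos hy).continuousAt
  have h1 : ContinuousAt Real.Gamma (x + y) :=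
    (differentiableAt_Gamma_of_pos (add_pos hx hy)).continuousAt
  have h2 : ContinuousAt (fun t => Real.Gamma (x + t)) y :=
    ContinuousAt.comp' (f := fun t => x + t) h1 (by fun_prop)
  exact (h0.const_mul _).div h2 (Real.Gamma_pos_of_pos (add_pos hx hy)).ne'

theorem beta_comm (x y : ℝ) : ProbabilityTheory.beta x y = ProbabilityTheory.beta y x := by
  rw [ProbabilityTheory.beta, ProbabilityTheory.beta, mul_comm, add_comm]

/-- An inequality between powers of beta functions near the singularity in the second variable
fails unless the exponents match. -/
theorem not_forall_beta_rpow_le {x X δ p C : ℝ} (hx : 0 < x) (hX : 0 < X) (hδ : 0 ≤ δ)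
    (hp : 1 ≤ p) (hpδ : 1 < p ∨ 0 < δ) :
    ¬ ∀ y : ℝ, 0 < y → ProbabilityTheory.beta x y ^ p ≤
      C * ProbabilityTheory.beta X (δ + p * y) := by
  intro H
  have hp0 : 0 < p := by linarith
  -- After multiplication of the inequality by `y ^ p`, the left side tends to `1` and the right
  -- side to `0`.
  have h1 : Tendsto (fun y => (y * ProbabilityTheory.beta x y) ^ p) (𝓝[>] 0) (𝓝 1) := by
    simpa using (tendsto_mul_beta hx).rpow_const (p := p) (Or.inl one_ne_zero)
  have hid : Tendsto (fun y : ℝ => y) (𝓝[>] 0) (𝓝 0) := nhdsWithin_le_nhds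
  have h2 : Tendsto (fun y => y ^ p * (C * ProbabilityTheory.beta X (δ + p * y))) (𝓝[>] 0)
      (𝓝 0) := by
    rcases hδ.eq_or_lt with rfl | hδ
    · have hp1 : 1 < p := hpδ.resolve_right (lt_irrefl _)
      have h3 : Tendsto (fun y : ℝ => p * y) (𝓝[>] 0) (𝓝[>] 0) := by
        refine tendsto_nhdsWithin_iff.2 ⟨by simpa using hid.const_mul p, ?_⟩
        filter_upwards [self_mem_nhdsWithin] with y hy using mul_pos hp0 hy
      have h4 := ((tendsto_mul_beta hX).comp h3).const_mul (C / p)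
      have h5 : Tendsto (fun y : ℝ => y ^ (p - 1)) (𝓝[>] 0) (𝓝 0) := by
        have := hid.rpow_const (p := p - 1) (Or.inr (by linarith))
        rwa [Real.zero_rpow (by linarith)] at this
      have h6 := h5.mul h4
      rw [zero_mul] at h6
      refine h6.congr' ?_
      filter_upwards [self_mem_nhdsWithin] with y hy
      have hy' : y ≠ 0 := ne_of_gt hy
      simp only [Function.comp, zero_add]
      rw [Real.rpow_sub_one hy']
      field_simp
    · have h3 : Tendsto (fun y : ℝ => δ + p * y) (𝓝[>] 0) (𝓝 δ) := by
        simpa using (hid.const_mul p).const_add δ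
      have h4 := ((continuousAt_beta hX hδ).tendsto.comp h3).const_mul C
      have h5 : Tendsto (fun y : ℝ => y ^ p) (𝓝[>] 0) (𝓝 0) := by
        have := hid.rpow_const (p := p) (Or.inr hp0.le)
        rwa [Real.zero_rpow hp0.ne'] at this
      have h6 := h5.mul h4
      rwa [zero_mul] at h6
  refine absurd (le_of_tendsto_of_tendsto h1 h2 ?_) (by norm_num)
  filter_upwards [self_mem_nhdsWithin] with y hy
  have hy0 : (0 : ℝ) < y := hy
  rw [Real.mul_rpow hy0.le (ProbabilityTheory.beta_pos hx hy0).le]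
  exact mul_le_mul_of_nonneg_left (H y hy0) (Real.rpow_nonneg hy0.le _)

/-! ### Integrals of homogeneous functions against radial weights -/

section Polar

variable {E : Type*} [NormedAddCommGroup E] [NormedSpace ℝ E] [MeasurableSpace E] [BorelSpace E]
  [FiniteDimensional ℝ E]

/-- Integration in polar coordinates of a homogeneous function times a radial function. -/
theorem lintegral_homogeneous_mul_norm (μ : Measure E) [μ.IsAddHaarMeasure] [Nontrivial E]
    {F : E → ℝ≥0∞} (hF : Measurable F) {m : ℕ}
    (hom : ∀ (r : ℝ) (x : E), 0 < r → F (r • x) = ENNReal.ofReal (r ^ m) * F x)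
    {g : ℝ → ℝ≥0∞} (hg : Measurable g) :
    ∫⁻ x, F x * g ‖x‖ ∂μ = (∫⁻ x : Metric.sphere (0 : E) 1, F x ∂μ.toSphere) *
      ∫⁻ r in Ioi (0 : ℝ), ENNReal.ofReal (r ^ (Module.finrank ℝ E - 1)) *
        (ENNReal.ofReal (r ^ m) * g r) := by
  have h1 : ∫⁻ x, F x * g ‖x‖ ∂μ =
      ∫⁻ x : ({(0)}ᶜ : Set E), F x * g ‖x.1‖ ∂(μ.comap (↑)) := by
    rw [lintegral_subtype_comap (measurableSet_singleton _).compl fun x => F x * g ‖x‖,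
      restrict_compl_singleton]
  have h2 := μ.measurePreserving_homeomorphUnitSphereProd.lintegral_comp_emb
    (Homeomorph.measurableEmbedding _)
    (fun q : Metric.sphere (0 : E) 1 × Ioi (0 : ℝ) =>
      F q.1 * (ENNReal.ofReal (q.2.1 ^ m) * g q.2.1))
  have h3 : ∀ x : ({(0)}ᶜ : Set E), F x * g ‖x.1‖ =
      (fun q : Metric.sphere (0 : E) 1 × Ioi (0 : ℝ) =>
      F q.1 * (ENNReal.ofReal (q.2.1 ^ m) * g q.2.1)) (homeomorphUnitSphereProd E x) := by
    intro x
    have hx : 0 < ‖x.1‖ := norm_pos_iff.2 x.2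
    have : F x = ENNReal.ofReal (‖x.1‖ ^ m) * F (‖x.1‖⁻¹ • x.1) := by
      rw [← hom _ _ hx, smul_smul, mul_inv_cancel₀ hx.ne', one_smul]
    simp only [homeomorphUnitSphereProd_apply_fst_coe, homeomorphUnitSphereProd_apply_snd_coe]
    rw [this]; ring
  rw [h1]
  simp_rw [h3]
  rw [h2, lintegral_prod_mul (f := fun x : Metric.sphere (0 : E) 1 => F x)
    (g := fun r : Ioi (0 : ℝ) => ENNReal.ofReal (r.1 ^ m) * g r.1)
    (by fun_prop) (by fun_prop)]
  congr 1
  rw [Measure.volumeIoiPow, lintegral_withDensity_eq_lintegral_mul _ (by fun_prop) (by fun_prop)]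
  exact lintegral_subtype_comap measurableSet_Ioi
    (fun r : ℝ => ENNReal.ofReal (r ^ (Module.finrank ℝ E - 1)) * (ENNReal.ofReal (r ^ m) * g r))

end Polar

/-- The beta integral after the substitution `x = r ^ 2`. -/
theorem lintegral_rpow_mul_one_sub_sq {α β : ℝ} (hα : 0 < α) (hβ : 0 < β) :
    ∫⁻ r in Ioo (0 : ℝ) 1, ENNReal.ofReal (r ^ (2 * α - 1) * (1 - r ^ 2) ^ (β - 1)) =
      ENNReal.ofReal (2⁻¹ * ProbabilityTheory.beta α β) := by
  have hB := ProbabilityTheory.beta_pos hα hβ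
  have h0 := ProbabilityTheory.lintegral_betaPDF_eq_one hα hβ
  rw [ProbabilityTheory.lintegral_betaPDF] at h0
  have himg : (fun r : ℝ => r ^ 2) '' Ioo 0 1 = Ioo 0 1 := by
    ext x
    constructor
    · rintro ⟨r, hr, rfl⟩
      exact ⟨pow_pos hr.1 2, pow_lt_one₀ hr.1.le hr.2 two_ne_zero⟩
    · intro hx
      refine ⟨√x, ⟨Real.sqrt_pos.2 hx.1, ?_⟩, Real.sq_sqrt hx.1.le⟩
      rw [Real.sqrt_lt' one_pos]; simpa using hx.2
  have hinj : InjOn (fun r : ℝ => r ^ 2) (Ioo 0 1) := fun x hx y hy h =>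
    (pow_left_inj₀ hx.1.le hy.1.le two_ne_zero).1 h
  have h1 := lintegral_image_eq_lintegral_abs_deriv_mul measurableSet_Ioo
    (fun r (_ : r ∈ Ioo (0 : ℝ) 1) => (hasDerivAt_pow 2 r).hasDerivWithinAt) hinj
    (fun x => ENNReal.ofReal (1 / ProbabilityTheory.beta α β * x ^ (α - 1) * (1 - x) ^ (β - 1)))
  rw [himg, h0] at h1
  have h2 : ∫⁻ r in Ioo (0 : ℝ) 1, ENNReal.ofReal (r ^ (2 * α - 1) * (1 - r ^ 2) ^ (β - 1)) =
      ENNReal.ofReal (2⁻¹ * ProbabilityTheory.beta α β) * 1 := by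
    rw [h1, ← lintegral_const_mul']
    · refine setLIntegral_congr_fun measurableSet_Ioo fun r hr => ?_
      rw [← ENNReal.ofReal_mul (abs_nonneg _), ← ENNReal.ofReal_mul (by positivity)]
      congr 1
      have hr0 : 0 < r := hr.1
      have e1 : (r ^ 2) ^ (α - 1) * r = r ^ (2 * α - 1) := by
        rw [← Real.rpow_natCast r 2, ← Real.rpow_mul hr0.le]
        nth_rewrite 2 [← Real.rpow_one r]
        rw [← Real.rpow_add hr0]
        congr 1; push_cast; ring
      rw [← e1]
      simp only [Nat.cast_ofNat, Nat.add_one_sub_one, pow_one]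
      rw [abs_of_pos (by positivity)]
      field_simp
    · exact ENNReal.ofReal_ne_top
  rw [h2, mul_one]

/-! ### Moments of `|⟨w, z⟩|` on the unit sphere, from Gaussian integrals. -/

section Sphere

variable {n : ℕ}

theorem lintegral_complex_pow_mul_exp (k : ℕ) :
    Integrable (fun x : ℂ => ‖x‖ ^ (2 * k) * Real.exp (-‖x‖ ^ 2)) ∧
    ∫ x : ℂ, ‖x‖ ^ (2 * k) * Real.exp (-‖x‖ ^ 2) = Real.pi * k.factorial := by
  have h := Complex.integral_rpow_mul_exp_neg_rpow (p := 2) (q := 2 * k) (by norm_num)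
    (by have : (0 : ℝ) ≤ k := k.cast_nonneg
        linarith)
  have e : ∀ x : ℂ, ‖x‖ ^ (2 * (k : ℝ)) * Real.exp (-‖x‖ ^ (2 : ℝ)) =
      ‖x‖ ^ (2 * k) * Real.exp (-‖x‖ ^ 2) := fun x => by
    rw [Real.rpow_two, ← Real.rpow_natCast ‖x‖ (2 * k)]
    push_cast; rfl
  simp only [e] at h
  have h2 : ∫ x : ℂ, ‖x‖ ^ (2 * k) * Real.exp (-‖x‖ ^ 2) = Real.pi * k.factorial := by
    rw [h, show (2 * (k : ℝ) + 2) / 2 = k + 1 by ring, Real.Gamma_nat_eq_factorial]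
    ring
  refine ⟨?_, h2⟩
  -- The Bochner integral of a non-integrable function is `0`, so a nonzero value proves
  -- integrability.
  by_contra hni
  rw [integral_undef hni] at h2
  have : 0 < Real.pi * k.factorial := by positivity
  linarith

/-- Gaussian moments of a coordinate on `ℂⁿ`. -/
theorem exists_lintegral_coord_pow_mul_exp (i : Fin n) :
    ∃ c : ℝ, 0 < c ∧ ∀ k : ℕ, ∫⁻ w : EuclideanSpace ℂ (Fin n),
      ENNReal.ofReal (‖w i‖ ^ (2 * k) * Real.exp (-‖w‖ ^ 2)) =
        ENNReal.ofReal (c * k.factorial) := by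
  let e : EuclideanSpace ℂ (Fin n) ≃L[ℝ] (Fin n → ℂ) :=
    PiLp.continuousLinearEquiv 2 ℝ (fun _ : Fin n => ℂ)
  let ν : Measure (Fin n → ℂ) := Measure.map e volume
  have hν : ν.IsAddHaarMeasure := e.isAddHaarMeasure_map volume
  -- Uniqueness of Haar measure moves the problem to the product `Fin n → ℂ`, where the Gaussian
  -- factorizes. The scaling factor `κ` does not depend on `k`, and only its positivity is used.
  have hsm := Measure.isAddLeftInvariant_eq_smul ν (volume : Measure (Fin n → ℂ))
  set κ := Measure.addHaarScalarFactor ν (volume : Measure (Fin n → ℂ)) with hκ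
  have hκ0 : 0 < κ := Measure.addHaarScalarFactor_pos_of_isAddHaarMeasure _ _
  refine ⟨κ * Real.pi ^ n, by positivity, fun k => ?_⟩
  let f : Fin n → ℂ → ℝ := fun j x => ‖x‖ ^ (2 * if j = i then k else 0) * Real.exp (-‖x‖ ^ 2)
  have hf : ∀ w : EuclideanSpace ℂ (Fin n), ‖w i‖ ^ (2 * k) * Real.exp (-‖w‖ ^ 2) =
      ∏ j, f j (e w j) := fun w => by
    simp only [f, Finset.prod_mul_distrib, ← Real.exp_sum, EuclideanSpace.norm_sq_eq,
      Finset.sum_neg_distrib]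
    congr 1
    simp [mul_ite, e]
  have hfm : ∀ j, Continuous (f j) := fun j => by fun_prop
  have h1 : ∫⁻ w : EuclideanSpace ℂ (Fin n),
      ENNReal.ofReal (‖w i‖ ^ (2 * k) * Real.exp (-‖w‖ ^ 2)) =
      ∫⁻ v : Fin n → ℂ, ENNReal.ofReal (∏ j, f j (v j)) ∂ν := by
    simp_rw [hf]
    rw [lintegral_map (by fun_prop) e.continuous.measurable]
  rw [h1, hsm, lintegral_smul_measure, ← ofReal_integral_eq_lintegral_ofReal]
  · rw [volume_pi, integral_fintype_prod_eq_prod]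
    simp only [f, (lintegral_complex_pow_mul_exp _).2, Finset.prod_mul_distrib]
    have h3 : ∏ j : Fin n, ((if j = i then k else 0).factorial : ℝ) = k.factorial := by
      rw [Finset.prod_eq_single i (fun j _ hj => by simp [hj]) (by simp)]
      simp
    rw [h3, Finset.prod_const, Finset.card_univ, Fintype.card_fin, ENNReal.smul_def, smul_eq_mul,
      mul_assoc, ENNReal.ofReal_mul (NNReal.coe_nonneg κ), ENNReal.ofReal_coe_nnreal]
  · exact Integrable.fintype_prod fun j => (lintegral_complex_pow_mul_exp _).1
  · exact Eventually.of_forall fun v => Finset.prod_nonneg fun j _ => by positivity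

/-- Every vector of `ℂⁿ` is carried to a multiple of a basis vector by a unitary map. -/
theorem exists_isometry_inner_eq (i : Fin n) (z : EuclideanSpace ℂ (Fin n)) :
    ∃ U : EuclideanSpace ℂ (Fin n) ≃ₗᵢ[ℝ] EuclideanSpace ℂ (Fin n),
      ∀ w, ‖(inner ℂ z w : ℂ)‖ = ‖z‖ * ‖U w i‖ := by
  rcases eq_or_ne z 0 with rfl | hz
  · exact ⟨LinearIsometryEquiv.refl ℝ _, fun w => by simp⟩
  have hz' : (‖z‖ : ℂ) ≠ 0 := by simpa using hz
  let u : EuclideanSpace ℂ (Fin n) := (‖z‖ : ℂ)⁻¹ • z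
  have hu : ‖u‖ = 1 := by
    simp only [u, norm_smul, norm_inv, Complex.norm_real, norm_norm]
    exact inv_mul_cancel₀ (norm_ne_zero_iff.2 hz)
  -- Prescribing `u = z / ‖z‖` on the index set `{i}` makes the extended basis carry it exactly at
  -- `i`; the isometry is then the coordinate map.
  have ho : Orthonormal ℂ (({i} : Set (Fin n)).domRestrict fun _ : Fin n => u) := by
    constructor
    · intro j; exact hu
    · intro j l hjl; exact absurd (Subsingleton.elim j l) hjl
  obtain ⟨b, hb⟩ := ho.exists_orthonormalBasis_extension_of_card_eq (by simp)
  let U₀ : EuclideanSpace ℂ (Fin n) ≃ₗᵢ[ℂ] EuclideanSpace ℂ (Fin n) := b.repr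
  refine ⟨{ U₀.toLinearEquiv.restrictScalars ℝ with norm_map' := U₀.norm_map }, fun w => ?_⟩
  have h1 : (U₀ w) i = inner ℂ u w := by
    rw [b.repr_apply_apply, hb i rfl]
  change _ = ‖z‖ * ‖(U₀ w) i‖
  have h2 : z = (‖z‖ : ℂ) • u := by simp only [u, smul_smul, mul_inv_cancel₀ hz', one_smul]
  rw [h1]
  conv_lhs => rw [h2]
  rw [inner_smul_left, norm_mul]
  simp

/-- The Gaussian measure is invariant under isometries, so `z` may be turned into a multiple of a
basis vector. -/
theorem exists_lintegral_inner_pow_mul_exp (hn : 1 ≤ n) :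
    ∃ c : ℝ, 0 < c ∧ ∀ (k : ℕ) (z : EuclideanSpace ℂ (Fin n)),
      ∫⁻ w : EuclideanSpace ℂ (Fin n),
        ENNReal.ofReal (‖(inner ℂ z w : ℂ)‖ ^ (2 * k)) * ENNReal.ofReal (Real.exp (-‖w‖ ^ 2)) =
        ENNReal.ofReal (c * k.factorial * ‖z‖ ^ (2 * k)) := by
  obtain ⟨c, hc, h⟩ := exists_lintegral_coord_pow_mul_exp (⟨0, hn⟩ : Fin n)
  refine ⟨c, hc, fun k z => ?_⟩
  obtain ⟨U, hU⟩ := exists_isometry_inner_eq (⟨0, hn⟩ : Fin n) z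
  have hmp := U.measurePreserving
  have h1 : ∀ w : EuclideanSpace ℂ (Fin n),
      ENNReal.ofReal (‖(inner ℂ z w : ℂ)‖ ^ (2 * k)) * ENNReal.ofReal (Real.exp (-‖w‖ ^ 2)) =
      ENNReal.ofReal (‖z‖ ^ (2 * k)) * ENNReal.ofReal (‖U w ⟨0, hn⟩‖ ^ (2 * k) *
        Real.exp (-‖U w‖ ^ 2)) := fun w => by
    rw [hU, mul_pow, U.norm_map, ENNReal.ofReal_mul (by positivity), mul_assoc,
      ← ENNReal.ofReal_mul (by positivity)]
  simp_rw [h1]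
  rw [lintegral_const_mul' _ _ ENNReal.ofReal_ne_top,
    hmp.lintegral_comp_emb U.toHomeomorph.measurableEmbedding
      (fun w : EuclideanSpace ℂ (Fin n) =>
        ENNReal.ofReal (‖w ⟨0, hn⟩‖ ^ (2 * k) * Real.exp (-‖w‖ ^ 2))), h,
    ← ENNReal.ofReal_mul (by positivity), mul_comm]

theorem lintegral_pow_mul_exp_neg_sq (hn : 1 ≤ n) (k : ℕ) :
    ∫⁻ r in Ioi (0 : ℝ), ENNReal.ofReal (r ^ (2 * n - 1)) *
      (ENNReal.ofReal (r ^ (2 * k)) * ENNReal.ofReal (Real.exp (-r ^ 2))) =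
      ENNReal.ofReal (Real.Gamma (k + n) / 2) := by
  have hn' : (1 : ℝ) ≤ n := by exact_mod_cast hn
  have hk : (0 : ℝ) ≤ k := k.cast_nonneg
  have h := integral_rpow_mul_exp_neg_rpow (p := 2) (q := 2 * n - 1 + 2 * k) (by norm_num)
    (by linarith)
  have hpos : 0 < Real.Gamma (k + n) / 2 := by
    have := Real.Gamma_pos_of_pos (by positivity : 0 < (k : ℝ) + n)
    positivity
  rw [show (2 * (n : ℝ) - 1 + 2 * k + 1) / 2 = k + n by ring, one_div_mul_eq_div] at h
  have hint : IntegrableOn (fun x : ℝ => x ^ (2 * (n : ℝ) - 1 + 2 * k) * Real.exp (-x ^ (2 : ℝ)))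
      (Ioi 0) := by
    by_contra hni
    rw [integral_undef hni] at h
    linarith
  rw [← h, ofReal_integral_eq_lintegral_ofReal hint]
  · refine setLIntegral_congr_fun measurableSet_Ioi fun r hr => ?_
    have hr0 : (0 : ℝ) < r := hr
    rw [← ENNReal.ofReal_mul (by positivity), ← ENNReal.ofReal_mul (by positivity), ← mul_assoc,
      ← pow_add, Real.rpow_two, ← Real.rpow_natCast]
    congr 3
    push_cast [Nat.cast_sub (by omega : 1 ≤ 2 * n)]
    ring
  · filter_upwards [ae_restrict_mem measurableSet_Ioi] with r hr
    have hr0 : (0 : ℝ) < r := hr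
    positivity

theorem finrank_real_euclideanSpace_complex :
    Module.finrank ℝ (EuclideanSpace ℂ (Fin n)) = 2 * n := by
  rw [finrank_real_of_complex, finrank_euclideanSpace_fin]

/-- Moments of `|⟨w, z⟩|` on the unit sphere of `ℂⁿ`. -/
theorem exists_lintegral_sphere_inner_pow (hn : 1 ≤ n) :
    ∃ c : ℝ, 0 < c ∧ ∀ (k : ℕ) (z : EuclideanSpace ℂ (Fin n)),
      ∫⁻ w : Metric.sphere (0 : EuclideanSpace ℂ (Fin n)) 1,
        ENNReal.ofReal (‖(inner ℂ z w.1 : ℂ)‖ ^ (2 * k)) ∂(volume : Measure _).toSphere =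
        ENNReal.ofReal (c * (k.factorial / Real.Gamma (k + n)) * ‖z‖ ^ (2 * k)) := by
  obtain ⟨c, hc, h⟩ := exists_lintegral_inner_pow_mul_exp hn
  refine ⟨2 * c, by positivity, fun k z => ?_⟩
  have hnt : Nontrivial (EuclideanSpace ℂ (Fin n)) :=
    Module.nontrivial_of_finrank_pos (R := ℝ) (by rw [finrank_real_euclideanSpace_complex]; omega)
  have hG := Real.Gamma_pos_of_pos (by positivity : 0 < (k : ℝ) + n)
  -- In polar coordinates the Gaussian moment is the sphere moment times a radial Gamma integral.
  -- Both the total and the radial factor are known, and division isolates the sphere moment.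
  have h1 := lintegral_homogeneous_mul_norm (volume : Measure (EuclideanSpace ℂ (Fin n)))
    (F := fun w => ENNReal.ofReal (‖(inner ℂ z w : ℂ)‖ ^ (2 * k))) (by fun_prop) (m := 2 * k)
    (fun r x hr => by
      rw [← ENNReal.ofReal_mul (by positivity), ← mul_pow]
      congr 2
      rw [← Complex.coe_smul, inner_smul_right, norm_mul, Complex.norm_real,
        Real.norm_of_nonneg hr.le])
    (g := fun r => ENNReal.ofReal (Real.exp (-r ^ 2))) (by fun_prop)
  rw [h, finrank_real_euclideanSpace_complex, lintegral_pow_mul_exp_neg_sq hn] at h1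
  have h2 : ENNReal.ofReal (Real.Gamma (k + n) / 2) ≠ 0 := by
    rw [Ne, ENNReal.ofReal_eq_zero]; push Not; positivity
  refine ((ENNReal.eq_div_iff h2 ENNReal.ofReal_ne_top).2
    ((mul_comm _ _).trans h1.symm)).trans ?_
  rw [← ENNReal.ofReal_div_of_pos (by positivity)]
  congr 1
  field_simp

end Sphere

/-! ### The radial weights -/

section Weight

variable {n : ℕ}

/-- The radial weight `|w| ^ (2 s) (1 - |w|²) ^ t`. -/
noncomputable def wt (s t : ℝ) (w : EuclideanSpace ℂ (Fin n)) : ℝ :=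
  ‖w‖ ^ (2 * s) * (1 - ‖w‖ ^ 2) ^ t

/-- Lebesgue measure on the unit ball. -/
noncomputable def volBall (n : ℕ) : Measure (EuclideanSpace ℂ (Fin n)) :=
  volume.restrict (Metric.ball 0 1)

@[fun_prop]
theorem measurable_wt (s t : ℝ) : Measurable (wt s t : EuclideanSpace ℂ (Fin n) → ℝ) := by
  unfold wt; fun_prop

/-- Integrals over the ball of powers of `|⟨w, z⟩|` against a radial weight. -/
theorem exists_lintegral_inner_pow_mul_wt (hn : 1 ≤ n) :
    ∃ c : ℝ, 0 < c ∧ ∀ (k : ℕ) (z : EuclideanSpace ℂ (Fin n)) (s t : ℝ), -(n : ℝ) < s → -1 < t →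
      ∫⁻ w, ENNReal.ofReal (‖(inner ℂ z w : ℂ)‖ ^ (2 * k)) * ENNReal.ofReal (wt s t w) ∂volBall n =
        ENNReal.ofReal (c * (k.factorial / Real.Gamma (k + n)) *
          ProbabilityTheory.beta (k + (n + s)) (t + 1) * ‖z‖ ^ (2 * k)) := by
  obtain ⟨c, hc, h⟩ := exists_lintegral_sphere_inner_pow hn
  refine ⟨c / 2, by positivity, fun k z s t hs ht => ?_⟩
  have hnt : Nontrivial (EuclideanSpace ℂ (Fin n)) :=
    Module.nontrivial_of_finrank_pos (R := ℝ) (by rw [finrank_real_euclideanSpace_complex]; omega)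
  have hG := Real.Gamma_pos_of_pos (by positivity : 0 < (k : ℝ) + n)
  have hk : (0 : ℝ) ≤ k := k.cast_nonneg
  -- The ball is encoded in the radial factor by the indicator of `r < 1`, which turns the radial
  -- integral into a beta integral.
  have h1 := lintegral_homogeneous_mul_norm (volume : Measure (EuclideanSpace ℂ (Fin n)))
    (F := fun w => ENNReal.ofReal (‖(inner ℂ z w : ℂ)‖ ^ (2 * k))) (by fun_prop) (m := 2 * k)
    (fun r x hr => by
      rw [← ENNReal.ofReal_mul (by positivity), ← mul_pow]
      congr 2
      rw [← Complex.coe_smul, inner_smul_right, norm_mul, Complex.norm_real,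
        Real.norm_of_nonneg hr.le])
    (g := (Iio 1).indicator fun r => ENNReal.ofReal (r ^ (2 * s) * (1 - r ^ 2) ^ t))
    (Measurable.indicator (by fun_prop) measurableSet_Iio)
  have h2 : ∫⁻ r in Ioi (0 : ℝ), ENNReal.ofReal (r ^ (2 * n - 1)) *
      (ENNReal.ofReal (r ^ (2 * k)) *
        (Iio 1).indicator (fun r => ENNReal.ofReal (r ^ (2 * s) * (1 - r ^ 2) ^ t)) r) =
      ENNReal.ofReal (2⁻¹ * ProbabilityTheory.beta (k + (n + s)) (t + 1)) := by
    rw [← lintegral_rpow_mul_one_sub_sq (by linarith) (by linarith), ← Iio_inter_Ioi,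
      ← Measure.restrict_restrict measurableSet_Iio, ← lintegral_indicator measurableSet_Iio]
    refine setLIntegral_congr_fun measurableSet_Ioi fun r hr => ?_
    have hr0 : (0 : ℝ) < r := hr
    by_cases hr1 : r < 1
    · rw [indicator_of_mem (show r ∈ Iio 1 from hr1), indicator_of_mem (show r ∈ Iio 1 from hr1),
        ← ENNReal.ofReal_mul (by positivity), ← ENNReal.ofReal_mul (by positivity)]
      congr 1
      rw [← mul_assoc, ← mul_assoc, ← pow_add, ← Real.rpow_natCast, ← Real.rpow_add hr0]
      congr 2
      · push_cast [Nat.cast_sub (by omega : 1 ≤ 2 * n)]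
        ring
      · ring
    · rw [indicator_of_notMem (show r ∉ Iio 1 from hr1),
        indicator_of_notMem (show r ∉ Iio 1 from hr1)]
      simp
  rw [finrank_real_euclideanSpace_complex, h, h2, ← ENNReal.ofReal_mul (by positivity)] at h1
  rw [volBall, ← lintegral_indicator measurableSet_ball]
  convert h1 using 1
  · refine lintegral_congr fun w => ?_
    by_cases hw : ‖w‖ < 1
    · rw [indicator_of_mem (by simpa using hw), indicator_of_mem (by simpa using hw), wt]
    · rw [indicator_of_notMem (by simpa using hw), indicator_of_notMem (by simpa using hw),
        mul_zero]
  · congr 1; ring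

end Weight

/-! ### Power series with nonnegative coefficients on the unit disk -/

section PowerSeries

variable {c : ℕ → ℝ}

/-- The sum of the power series with real coefficients `c`. -/
noncomputable def psum (c : ℕ → ℝ) (ξ : ℂ) : ℂ := ∑' k, (c k : ℂ) * ξ ^ k

/-- `c` is a nonnegative sequence whose power series converges in the unit disk. -/
structure IsDiskSeries (c : ℕ → ℝ) : Prop where
  nonneg : ∀ k, 0 ≤ c k
  summable : ∀ r : ℝ, 0 ≤ r → r < 1 → Summable fun k => c k * r ^ k

theorem norm_coeff_mul_pow (hc : IsDiskSeries c) (ξ : ℂ) (k : ℕ) :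
    ‖(c k : ℂ) * ξ ^ k‖ = c k * ‖ξ‖ ^ k := by
  rw [norm_mul, norm_pow, Complex.norm_real, Real.norm_of_nonneg (hc.nonneg k)]

theorem continuousOn_psum (hc : IsDiskSeries c) : ContinuousOn (psum c) (Metric.ball 0 1) := by
  intro ξ hξ
  have hξ' : ‖ξ‖ < 1 := by simpa using hξ
  obtain ⟨r, hr1, hr2⟩ := exists_between hξ'
  have h1 : ContinuousOn (psum c) (Metric.ball 0 r) := by
    refine continuousOn_tsum (fun k => by fun_prop)
      (hc.summable r ((norm_nonneg _).trans hr1.le) hr2) fun k x hx => ?_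
    rw [norm_coeff_mul_pow hc]
    have hx' : ‖x‖ < r := by simpa using hx
    have := hc.nonneg k
    gcongr
  exact (h1.continuousAt (Metric.isOpen_ball.mem_nhds (by simpa using hr1))).continuousWithinAt

theorem integral_exp_int_mul_I (j k : ℕ) :
    ∫ θ in (0 : ℝ)..2 * Real.pi, Complex.exp (((j : ℂ) - k) * Complex.I * θ) =
      if j = k then (2 * Real.pi : ℂ) else 0 := by
  split_ifs with h
  · simp [h]
  · have hne : ((j : ℂ) - k) * Complex.I ≠ 0 :=
      mul_ne_zero (sub_ne_zero.2 (by exact_mod_cast h)) Complex.I_ne_zero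
    rw [integral_exp_mul_complex hne]
    have : Complex.exp (((j : ℂ) - k) * Complex.I * ((2 * Real.pi : ℝ) : ℂ)) = 1 := by
      rw [Complex.exp_eq_one_iff]
      exact ⟨(j : ℤ) - k, by push_cast; ring⟩
    rw [this]; simp

/-- Parseval's identity on a circle inside the unit disk. -/
theorem hasSum_integral_norm_psum_sq (hc : IsDiskSeries c) {ξ : ℂ} (hξ : ‖ξ‖ < 1) :
    HasSum (fun k => 2 * Real.pi * (c k ^ 2 * ‖ξ‖ ^ (2 * k)))
      (∫ θ in (0 : ℝ)..2 * Real.pi, ‖psum c (Complex.exp (θ * Complex.I) * ξ)‖ ^ 2) := by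
  let f : ℕ → ℝ → ℂ := fun k θ => (c k : ℂ) * (Complex.exp (θ * Complex.I) * ξ) ^ k
  let F : ℕ × ℕ → ℝ → ℂ := fun q θ => f q.1 θ * (starRingEnd ℂ) (f q.2 θ)
  have hnorm : ∀ θ : ℝ, ‖Complex.exp (θ * Complex.I) * ξ‖ = ‖ξ‖ := fun θ => by
    rw [norm_mul, Complex.norm_exp_ofReal_mul_I, one_mul]
  have hfn : ∀ k θ, ‖f k θ‖ = c k * ‖ξ‖ ^ k := fun k θ => by
    rw [norm_coeff_mul_pow hc, hnorm]
  have hfs : ∀ θ, Summable fun k => ‖f k θ‖ := fun θ => by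
    simp_rw [hfn]; exact hc.summable _ (norm_nonneg _) hξ
  have hFsum : ∀ θ : ℝ, ∑' q, F q θ =
      ((‖psum c (Complex.exp (θ * Complex.I) * ξ)‖ ^ 2 : ℝ) : ℂ) := fun θ => by
    have h1 : Summable fun k => ‖(starRingEnd ℂ) (f k θ)‖ := by simpa using hfs θ
    rw [← tsum_mul_tsum_of_summable_norm (hfs θ) h1]
    have h2 : ∑' k, (starRingEnd ℂ) (f k θ) =
        (starRingEnd ℂ) (psum c (Complex.exp (θ * Complex.I) * ξ)) :=
      (Complex.conj_tsum _).symm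
    rw [h2]
    change psum c (Complex.exp (θ * Complex.I) * ξ) * _ = _
    rw [Complex.mul_conj, Complex.normSq_eq_norm_sq]
  have hF : ∀ q, ∀ θ : ℝ, F q θ = (c q.1 * ξ ^ q.1 * (c q.2 * (starRingEnd ℂ) ξ ^ q.2)) *
      Complex.exp (((q.1 : ℂ) - q.2) * Complex.I * θ) := fun q θ => by
    simp only [F, f, mul_pow, map_mul, map_pow, Complex.conj_ofReal, ← Complex.exp_conj,
      Complex.conj_I, map_natCast, ← Complex.exp_nat_mul]
    rw [show ((q.1 : ℂ) - q.2) * Complex.I * θ = q.1 * (θ * Complex.I) + q.2 * (θ * -Complex.I) by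
      ring, Complex.exp_add]
    ring
  have hcont : ∀ q, Continuous (F q) := fun q => by
    rw [show F q = _ from funext (hF q)]; fun_prop
  have h2pi : (0 : ℝ) ≤ 2 * Real.pi := by positivity
  -- The squared modulus is the double series of products `f j * conj (f k)`, absolutely summable on
  -- the circle, hence integrable term by term.
  have key := hasSum_integral_of_summable_integral_norm (F := F)
    (μ := volume.restrict (Ioc 0 (2 * Real.pi)))
    (fun q => ((hcont q).integrableOn_Icc).mono_set Ioc_subset_Icc_self) (by
      have : ∀ q : ℕ × ℕ, ∫ θ, ‖F q θ‖ ∂volume.restrict (Ioc 0 (2 * Real.pi)) =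
          (2 * Real.pi) * ((c q.1 * ‖ξ‖ ^ q.1) * (c q.2 * ‖ξ‖ ^ q.2)) := fun q => by
        simp only [F, norm_mul, RCLike.norm_conj, hfn]
        rw [integral_const]
        simp [h2pi]
      simp_rw [this]
      have hs := hc.summable _ (norm_nonneg ξ) hξ
      have hn : ∀ k, 0 ≤ c k * ‖ξ‖ ^ k := fun k => mul_nonneg (hc.nonneg k) (by positivity)
      exact (hs.mul_of_nonneg hs hn hn).mul_left _)
  simp_rw [hFsum, ← intervalIntegral.integral_of_le h2pi] at key
  -- Orthogonality of the exponentials leaves only the diagonal terms.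
  have hdiag : Function.Injective fun k : ℕ => (k, k) := fun j k h => (Prod.mk.inj h).1
  rw [← hdiag.hasSum_iff] at key
  · rw [intervalIntegral.integral_ofReal] at key
    rw [← Complex.hasSum_ofReal]
    suffices e : (fun k => ((2 * Real.pi * (c k ^ 2 * ‖ξ‖ ^ (2 * k)) : ℝ) : ℂ)) =
        (fun q => ∫ θ in (0 : ℝ)..2 * Real.pi, F q θ) ∘ fun k => (k, k) by
      rw [e]; exact key
    funext k
    simp only [Function.comp_apply, hF]
    rw [intervalIntegral.integral_const_mul, integral_exp_int_mul_I, if_pos rfl]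
    have : ((‖ξ‖ ^ (2 * k) : ℝ) : ℂ) = ξ ^ k * (starRingEnd ℂ) ξ ^ k := by
      rw [← mul_pow, Complex.mul_conj, Complex.normSq_eq_norm_sq, pow_mul]; push_cast; rfl
    push_cast at this ⊢
    rw [this]; ring
  · rintro ⟨j, k⟩ hjk
    have hne : j ≠ k := fun h => hjk ⟨j, by rw [h]⟩
    simp only [hF]
    rw [intervalIntegral.integral_const_mul, integral_exp_int_mul_I, if_neg hne, mul_zero]

/-- The square of the absolute value of the power series, extended by `0` outside the disk. -/
noncomputable def sqNorm (c : ℕ → ℝ) : ℂ → ℝ :=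
  (Metric.ball 0 1).indicator fun ξ => ‖psum c ξ‖ ^ 2

theorem sqNorm_nonneg (c : ℕ → ℝ) (ξ : ℂ) : 0 ≤ sqNorm c ξ :=
  indicator_nonneg (fun _ _ => by positivity) ξ

theorem sqNorm_of_lt {ξ : ℂ} (hξ : ‖ξ‖ < 1) : sqNorm c ξ = ‖psum c ξ‖ ^ 2 :=
  indicator_of_mem (by simpa using hξ) _

/-- Extension by zero gives measurability on all of `ℂ`, so that Tonelli applies without tracking
where `⟨w, z⟩` lies in the disk. -/
theorem measurable_sqNorm (hc : IsDiskSeries c) : Measurable (sqNorm c) := by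
  have h : ContinuousOn (fun ξ => ‖psum c ξ‖ ^ 2) (Metric.ball 0 1) :=
    (continuousOn_psum hc).norm.pow 2
  classical
  have := h.measurable_piecewise (g := 0) (by fun_prop) Metric.isOpen_ball.measurableSet
  rwa [piecewise_eq_indicator] at this

theorem sqNorm_conj (ξ : ℂ) : sqNorm c ((starRingEnd ℂ) ξ) = sqNorm c ξ := by
  have h : psum c ((starRingEnd ℂ) ξ) = (starRingEnd ℂ) (psum c ξ) := by
    simp only [psum, Complex.conj_tsum]; simp
  by_cases hξ : ‖ξ‖ < 1
  · rw [sqNorm_of_lt hξ, sqNorm_of_lt (by simpa using hξ), h, RCLike.norm_conj]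
  · rw [sqNorm, indicator_of_notMem (by simpa using hξ), indicator_of_notMem (by simpa using hξ)]

theorem lintegral_sqNorm_rotate (hc : IsDiskSeries c) {ξ : ℂ} (hξ : ‖ξ‖ < 1) :
    ∫⁻ θ in Ioc (0 : ℝ) (2 * Real.pi),
      ENNReal.ofReal (sqNorm c (Complex.exp (θ * Complex.I) * ξ)) =
    ENNReal.ofReal (2 * Real.pi) * ∑' k, ENNReal.ofReal (c k ^ 2 * ‖ξ‖ ^ (2 * k)) := by
  have hnorm : ∀ θ : ℝ, ‖Complex.exp (θ * Complex.I) * ξ‖ < 1 := fun θ => by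
    rwa [norm_mul, Complex.norm_exp_ofReal_mul_I, one_mul]
  have h2pi : (0 : ℝ) ≤ 2 * Real.pi := by positivity
  have h := hasSum_integral_norm_psum_sq hc hξ
  simp_rw [sqNorm_of_lt (hnorm _)]
  have hcont : Continuous fun θ : ℝ => ‖psum c (Complex.exp (θ * Complex.I) * ξ)‖ ^ 2 := by
    refine (Continuous.norm ?_).pow 2
    exact (continuousOn_psum hc).comp_continuous (by fun_prop) fun θ => by simpa using hnorm θ
  rw [← ofReal_integral_eq_lintegral_ofReal
    (hcont.integrableOn_Icc.mono_set Ioc_subset_Icc_self)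
    (Eventually.of_forall fun _ => by positivity), ← intervalIntegral.integral_of_le h2pi,
    ← h.tsum_eq, ENNReal.ofReal_tsum_of_nonneg (fun k => by positivity) h.summable,
    ← ENNReal.tsum_mul_left]
  exact tsum_congr fun k => ENNReal.ofReal_mul h2pi

end PowerSeries

/-! ### Integrals over the ball of `|Σ c_k ⟨w, z⟩^k|²`. -/

section Ball

variable {n : ℕ} {c : ℕ → ℝ}

theorem norm_inner_lt_one {z w : EuclideanSpace ℂ (Fin n)} (hz : ‖z‖ < 1) (hw : ‖w‖ < 1) :
    ‖(inner ℂ z w : ℂ)‖ < 1 :=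
  (norm_inner_le_norm z w).trans_lt (mul_lt_one_of_nonneg_of_lt_one_left (norm_nonneg _) hz hw.le)

theorem ae_volBall : ∀ᵐ w ∂volBall n, ‖w‖ < 1 := by
  filter_upwards [ae_restrict_mem (μ := volume) (Metric.isOpen_ball.measurableSet :
    MeasurableSet (Metric.ball (0 : EuclideanSpace ℂ (Fin n)) 1))] with w hw using by simpa using hw

instance : SFinite (volBall n) := by unfold volBall; infer_instance

/-- Multiplication by `exp (i θ)` preserves Lebesgue measure on the ball. -/
theorem measurePreserving_rotate (θ : ℝ) :
    MeasurePreserving (fun w : EuclideanSpace ℂ (Fin n) => Complex.exp (θ * Complex.I) • w)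
      (volBall n) (volBall n) := by
  have hne : Complex.exp (θ * Complex.I) ≠ 0 := Complex.exp_ne_zero _
  let U : EuclideanSpace ℂ (Fin n) ≃ₗᵢ[ℝ] EuclideanSpace ℂ (Fin n) :=
    { (LinearEquiv.smulOfNeZero ℂ (EuclideanSpace ℂ (Fin n)) _ hne).restrictScalars ℝ with
      norm_map' := fun w => by
        change ‖Complex.exp (θ * Complex.I) • w‖ = ‖w‖
        rw [norm_smul, Complex.norm_exp_ofReal_mul_I, one_mul] }
  have h := U.measurePreserving.restrict_preimage
    (Metric.isOpen_ball.measurableSet : MeasurableSet (Metric.ball (0 : EuclideanSpace ℂ (Fin n)) 1))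
  have hpre : U ⁻¹' Metric.ball 0 1 = Metric.ball 0 1 := by
    ext w; simp
  rw [hpre] at h
  exact h

/-- Averaging over rotations turns `|Σ c_k ξ^k|²` into `Σ c_k² |ξ|^(2k)`. -/
theorem lintegral_sqNorm_inner (hc : IsDiskSeries c) {z : EuclideanSpace ℂ (Fin n)} (hz : ‖z‖ < 1)
    {G : EuclideanSpace ℂ (Fin n) → ℝ≥0∞} (hG : Measurable G)
    (hrot : ∀ (θ : ℝ) w, G (Complex.exp (θ * Complex.I) • w) = G w) :
    ∫⁻ w, ENNReal.ofReal (sqNorm c (inner ℂ z w)) * G w ∂volBall n =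
      ∑' k, ENNReal.ofReal (c k ^ 2) *
        ∫⁻ w, ENNReal.ofReal (‖(inner ℂ z w : ℂ)‖ ^ (2 * k)) * G w ∂volBall n := by
  have hm := measurable_sqNorm hc
  -- Each rotation leaves the integral unchanged. Integrating over `θ`, exchanging the integrals and
  -- applying Parseval for fixed `w` gives the diagonal series, up to the common factor `2π`.
  have h1 : ∀ θ : ℝ, ∫⁻ w, ENNReal.ofReal (sqNorm c (inner ℂ z w)) * G w ∂volBall n =
      ∫⁻ w, ENNReal.ofReal (sqNorm c (Complex.exp (θ * Complex.I) * inner ℂ z w)) * G w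
        ∂volBall n := fun θ => by
    rw [← (measurePreserving_rotate θ).lintegral_comp (by fun_prop)]
    simp_rw [hrot, inner_smul_right]
  have h2 : ENNReal.ofReal (2 * Real.pi) *
      ∫⁻ w, ENNReal.ofReal (sqNorm c (inner ℂ z w)) * G w ∂volBall n =
      ENNReal.ofReal (2 * Real.pi) * ∑' k, ENNReal.ofReal (c k ^ 2) *
        ∫⁻ w, ENNReal.ofReal (‖(inner ℂ z w : ℂ)‖ ^ (2 * k)) * G w ∂volBall n := by
    have h3 : ∫⁻ θ in Ioc (0 : ℝ) (2 * Real.pi),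
        ∫⁻ w, ENNReal.ofReal (sqNorm c (inner ℂ z w)) * G w ∂volBall n =
        ENNReal.ofReal (2 * Real.pi) *
      ∫⁻ w, ENNReal.ofReal (sqNorm c (inner ℂ z w)) * G w ∂volBall n := by
      rw [setLIntegral_const, Real.volume_Ioc, sub_zero, mul_comm]
    rw [← h3]
    refine (lintegral_congr h1).trans ?_
    rw [lintegral_lintegral_swap (by fun_prop)]
    calc _ = ∫⁻ w, ENNReal.ofReal (2 * Real.pi) *
          ∑' k, ENNReal.ofReal (c k ^ 2) * (ENNReal.ofReal (‖(inner ℂ z w : ℂ)‖ ^ (2 * k)) * G w)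
          ∂volBall n := by
          refine lintegral_congr_ae ?_
          filter_upwards [ae_volBall] with w hw
          rw [lintegral_mul_const _ (by fun_prop), lintegral_sqNorm_rotate hc
            (norm_inner_lt_one hz hw), mul_assoc, ← ENNReal.tsum_mul_right]
          congr 1
          refine tsum_congr fun k => ?_
          rw [ENNReal.ofReal_mul (by positivity), mul_assoc]
      _ = _ := by
          rw [lintegral_const_mul' _ _ ENNReal.ofReal_ne_top,
            lintegral_tsum fun k => by fun_prop]
          congr 1
          exact tsum_congr fun k => lintegral_const_mul' _ _ ENNReal.ofReal_ne_top
  have hpi : ENNReal.ofReal (2 * Real.pi) ≠ 0 := by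
    rw [Ne, ENNReal.ofReal_eq_zero]; push Not; positivity
  exact (ENNReal.mul_right_inj hpi ENNReal.ofReal_ne_top).1 h2

theorem wt_rotate (s t θ : ℝ) (w : EuclideanSpace ℂ (Fin n)) :
    wt s t (Complex.exp (θ * Complex.I) • w) = wt s t w := by
  rw [wt, wt, norm_smul, Complex.norm_exp_ofReal_mul_I, one_mul]

/-- The integral of `|Σ c_k ⟨w, z⟩^k|²` against a radial weight. -/
theorem exists_lintegral_sqNorm_inner_mul_wt (hn : 1 ≤ n) :
    ∃ C : ℝ, 0 < C ∧ ∀ (c : ℕ → ℝ), IsDiskSeries c → ∀ (z : EuclideanSpace ℂ (Fin n)) (s t : ℝ),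
      ‖z‖ < 1 → -(n : ℝ) < s → -1 < t →
      ∫⁻ w, ENNReal.ofReal (sqNorm c (inner ℂ z w)) * ENNReal.ofReal (wt s t w) ∂volBall n =
        ∑' k : ℕ, ENNReal.ofReal (C * (c k ^ 2 * (k.factorial / Real.Gamma (k + n)) *
          ProbabilityTheory.beta (k + (n + s)) (t + 1) * (‖z‖ ^ 2) ^ k)) := by
  obtain ⟨C, hC, h⟩ := exists_lintegral_inner_pow_mul_wt hn
  refine ⟨C, hC, fun c hc z s t hz hs ht => ?_⟩
  rw [lintegral_sqNorm_inner hc hz (by fun_prop) (fun θ w => by rw [wt_rotate])]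
  refine tsum_congr fun k => ?_
  rw [h k z s t hs ht, ← ENNReal.ofReal_mul (by positivity), ← pow_mul]
  congr 1; ring

end Ball

/-! ### The coefficients of the reproducing kernel -/

section Coefficients

variable {n : ℕ} {a b : ℝ}

/-- The Taylor coefficients of `𝒦_{a,b}`. -/
noncomputable def kcoef (n : ℕ) (a b : ℝ) (k : ℕ) : ℝ :=
  (k.factorial : ℝ)⁻¹ * (ascPochhammer ℝ k).eval (n : ℝ) *
    (ascPochhammer ℝ k).eval (a + b + n + 1) * ((ascPochhammer ℝ k).eval (b + n))⁻¹

theorem kernel_eq_psum (n : ℕ) (a b : ℝ) : kernel n a b = psum (kcoef n a b) := by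
  funext ξ
  rw [kernel, ordinaryHypergeometric_eq_tsum, psum]
  refine tsum_congr fun k => ?_
  have h : ∀ x : ℝ, (ascPochhammer ℂ k).eval (x : ℂ) = ((ascPochhammer ℝ k).eval x : ℝ) :=
    fun x => by
      rw [← ascPochhammer_map Complex.ofRealHom k, ← Complex.ofRealHom_eq_coe,
        Polynomial.eval_map_apply]; rfl
  rw [smul_eq_mul, h, h, ← Complex.ofReal_natCast n, h, kcoef]
  push_cast
  rfl

theorem kcoef_zero (n : ℕ) (a b : ℝ) : kcoef n a b 0 = 1 := by simp [kcoef]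

theorem kcoef_eq (hn : 1 ≤ n) (ha : -1 < a) (hb : -(n : ℝ) < b) (k : ℕ) :
    kcoef n a b k = Real.Gamma (b + n) / (Real.Gamma n * Real.Gamma (a + b + n + 1)) *
      (Real.Gamma (k + n) * Real.Gamma (k + (a + b + n + 1)) /
        (Real.Gamma (k + (b + n)) * k.factorial)) := by
  have hn' : (0 : ℝ) < n := by exact_mod_cast hn
  have hk : (0 : ℝ) ≤ k := k.cast_nonneg
  have h1 := Real.Gamma_pos_of_pos hn'
  have h2 := Real.Gamma_pos_of_pos (by linarith : 0 < b + n)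
  have h3 := Real.Gamma_pos_of_pos (by linarith : 0 < a + b + n + 1)
  have h4 := Real.Gamma_pos_of_pos (by linarith : 0 < k + (b + n))
  rw [kcoef, ascPochhammer_eval_eq_Gamma hn', ascPochhammer_eval_eq_Gamma (by linarith),
    ascPochhammer_eval_eq_Gamma (by linarith)]
  have : (k.factorial : ℝ) ≠ 0 := by positivity
  field_simp

theorem kcoef_pos (hn : 1 ≤ n) (ha : -1 < a) (hb : -(n : ℝ) < b) (k : ℕ) : 0 < kcoef n a b k := by
  have hn' : (0 : ℝ) < n := by exact_mod_cast hn
  have hk : (0 : ℝ) ≤ k := k.cast_nonneg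
  have h1 := Real.Gamma_pos_of_pos hn'
  have h2 := Real.Gamma_pos_of_pos (by linarith : 0 < b + n)
  have h3 := Real.Gamma_pos_of_pos (by linarith : 0 < a + b + n + 1)
  have h4 := Real.Gamma_pos_of_pos (by linarith : 0 < k + (b + n))
  have h5 := Real.Gamma_pos_of_pos (by linarith : 0 < k + (n : ℝ))
  have h6 := Real.Gamma_pos_of_pos (by linarith : 0 < k + (a + b + n + 1))
  rw [kcoef_eq hn ha hb]
  positivity

/-- The exponents add up to `(n-1) + (a+b+n) - (b+n-1) = n + a`: the parameter `b` has no influence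
on the growth at the boundary. -/
theorem kcoef_isTheta (hn : 1 ≤ n) (ha : -1 < a) (hb : -(n : ℝ) < b) :
    kcoef n a b =Θ[⊤] fun k => ((k : ℝ) + 1) ^ (n + a) := by
  have hn' : (0 : ℝ) < n := by exact_mod_cast hn
  have h1 := Real.Gamma_pos_of_pos hn'
  have h2 := Real.Gamma_pos_of_pos (by linarith : 0 < b + n)
  have h3 := Real.Gamma_pos_of_pos (by linarith : 0 < a + b + n + 1)
  have h := ((Gamma_natCast_add_isTheta hn').mul
    (Gamma_natCast_add_isTheta (by linarith : 0 < a + b + n + 1))).div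
    ((Gamma_natCast_add_isTheta (by linarith : 0 < b + n)).mul
      (isTheta_refl (fun k : ℕ => (k.factorial : ℝ)) ⊤))
  have h' := (isTheta_const_mul_left (c := Real.Gamma (b + n) /
    (Real.Gamma n * Real.Gamma (a + b + n + 1))) (by positivity)).2 h
  refine (EventuallyEq.trans_isTheta (.of_eq (funext fun k => kcoef_eq hn ha hb k))
    h').trans_eventuallyEq (.of_eq (funext fun k => ?_))
  have hk : (0 : ℝ) < (k : ℝ) + 1 := by positivity
  have hf : (k.factorial : ℝ) ≠ 0 := by positivity
  have e : ((k : ℝ) + 1) ^ (n + a) = ((k : ℝ) + 1) ^ ((n : ℝ) - 1) *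
      ((k : ℝ) + 1) ^ (a + b + n + 1 - 1) / ((k : ℝ) + 1) ^ (b + n - 1) := by
    rw [← Real.rpow_add hk, ← Real.rpow_sub hk]; congr 1; ring
  have := Real.rpow_pos_of_pos hk (b + n - 1)
  rw [e]
  field_simp

theorem isDiskSeries_kcoef (hn : 1 ≤ n) (ha : -1 < a) (hb : -(n : ℝ) < b) :
    IsDiskSeries (kcoef n a b) := by
  have hn' : (0 : ℝ) < n := by exact_mod_cast hn
  obtain ⟨M, -, hM⟩ := exists_tsum_mul_pow_le (u := kcoef n a b) (s := n + a + 1) (by linarith)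
    (fun k => (kcoef_pos hn ha hb k).le)
    (by rw [add_sub_cancel_right]; exact (kcoef_isTheta hn ha hb).1)
  exact ⟨fun k => (kcoef_pos hn ha hb k).le, fun r h0 h1 => (hM r h0 h1).1⟩

/-- The values of `𝒦_{a,b}` on `[0, 1)`. -/
noncomputable def kreal (n : ℕ) (a b x : ℝ) : ℝ := ∑' k, kcoef n a b k * x ^ k

theorem kernel_ofReal (n : ℕ) (a b x : ℝ) : kernel n a b x = kreal n a b x := by
  rw [kernel_eq_psum, psum, kreal, Complex.ofReal_tsum]
  push_cast; rfl

/-- The constant term is `1` and the others are nonnegative; in particular the division by `𝒦(|z|²)`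
is harmless. -/
theorem one_le_kreal (hn : 1 ≤ n) (ha : -1 < a) (hb : -(n : ℝ) < b) {x : ℝ} (hx0 : 0 ≤ x)
    (hx1 : x < 1) : 1 ≤ kreal n a b x := by
  have h := (isDiskSeries_kcoef hn ha hb).summable x hx0 hx1
  have := h.le_tsum 0 fun k _ => mul_nonneg (kcoef_pos hn ha hb k).le (pow_nonneg hx0 k)
  rw [pow_zero, mul_one, kcoef_zero] at this
  exact this

theorem exists_kreal_le (hn : 1 ≤ n) (ha : -1 < a) (hb : -(n : ℝ) < b) :
    ∃ M : ℝ, 0 < M ∧ ∀ x, 0 ≤ x → x < 1 → kreal n a b x ≤ M * (1 - x) ^ (-(n + a + 1)) := by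
  have hn' : (0 : ℝ) < n := by exact_mod_cast hn
  obtain ⟨M, hM0, hM⟩ := exists_tsum_mul_pow_le (u := kcoef n a b) (s := n + a + 1) (by linarith)
    (fun k => (kcoef_pos hn ha hb k).le)
    (by rw [add_sub_cancel_right]; exact (kcoef_isTheta hn ha hb).1)
  exact ⟨M, hM0, fun x h0 h1 => (hM x h0 h1).2⟩

theorem exists_inv_kreal_le (hn : 1 ≤ n) (ha : -1 < a) (hb : -(n : ℝ) < b) :
    ∃ M : ℝ, 0 < M ∧ ∀ x, 0 ≤ x → x < 1 → (kreal n a b x)⁻¹ ≤ M * (1 - x) ^ (n + a + 1) := by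
  have hn' : (0 : ℝ) < n := by exact_mod_cast hn
  obtain ⟨m, hm0, hm⟩ := exists_le_tsum_mul_pow (u := kcoef n a b) (s := n + a + 1) (by linarith)
    (fun k => (kcoef_pos hn ha hb k).le)
    (by rw [add_sub_cancel_right]; exact (kcoef_isTheta hn ha hb))
  refine ⟨m⁻¹, by positivity, fun x h0 h1 => ?_⟩
  have hx : 0 < 1 - x := by linarith
  have := inv_anti₀ (mul_pos hm0 (Real.rpow_pos_of_pos hx _)) (hm x h0 h1)
  rwa [mul_inv, ← Real.rpow_neg hx.le, neg_neg] at this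

/-- Growth of the coefficients in the integral of `|𝒦(⟨w, z⟩)|²` against a radial weight. -/
theorem sq_kcoef_mul_beta_isTheta (hn : 1 ≤ n) (ha : -1 < a) (hb : -(n : ℝ) < b) {s t : ℝ}
    (hs : -(n : ℝ) < s) (ht : -1 < t) :
    (fun k : ℕ => kcoef n a b k ^ 2 * (k.factorial / Real.Gamma (k + n)) *
      ProbabilityTheory.beta (k + (n + s)) (t + 1)) =Θ[⊤]
      fun k => ((k : ℝ) + 1) ^ (n + 1 + 2 * a - t - 1) := by
  have hn' : (0 : ℝ) < n := by exact_mod_cast hn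
  have h1 := kcoef_isTheta hn ha hb
  have h2 := (isTheta_refl (fun k : ℕ => (k.factorial : ℝ)) ⊤).div (Gamma_natCast_add_isTheta hn')
  have h3 := beta_natCast_add_isTheta (by linarith : 0 < n + s) (by linarith : 0 < t + 1)
  refine (((h1.pow 2).mul h2).mul h3).trans_eventuallyEq (.of_eq (funext fun k => ?_))
  have hk : (0 : ℝ) < (k : ℝ) + 1 := by positivity
  have hf : (k.factorial : ℝ) ≠ 0 := by positivity
  rw [div_mul_eq_div_div, div_self hf, one_div, ← Real.rpow_neg hk.le, ← Real.rpow_natCast,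
    ← Real.rpow_mul hk.le, ← Real.rpow_add hk, ← Real.rpow_add hk]
  congr 1; push_cast; ring

end Coefficients

/-! ### Estimates for the Berezin kernel -/

section Estimates

variable {n : ℕ} {a b : ℝ}

/-- The kernel of the Berezin transform with respect to `μ_{a,b}`. -/
noncomputable def bkernel (n : ℕ) (a b : ℝ) (z w : EuclideanSpace ℂ (Fin n)) : ℝ :=
  sqNorm (kcoef n a b) (inner ℂ z w) * (kreal n a b (‖z‖ ^ 2))⁻¹

/-- Symmetry of the numerator lets one integral estimate serve both the rows and the columns of the
Berezin kernel. -/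
theorem sqNorm_inner_comm (c : ℕ → ℝ) (z w : EuclideanSpace ℂ (Fin n)) :
    sqNorm c (inner ℂ z w) = sqNorm c (inner ℂ w z) := by
  rw [← inner_conj_symm, sqNorm_conj]

theorem sq_norm_lt_one {z : EuclideanSpace ℂ (Fin n)} (hz : ‖z‖ < 1) : ‖z‖ ^ 2 < 1 :=
  pow_lt_one₀ (norm_nonneg _) hz two_ne_zero

theorem berezinIntegrand_eq (f : EuclideanSpace ℂ (Fin n) → ℂ) {z w : EuclideanSpace ℂ (Fin n)}
    (hz : ‖z‖ < 1) (hw : ‖w‖ < 1) :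
    berezinIntegrand n a b f z w = f w * (bkernel n a b z w : ℂ) := by
  rw [berezinIntegrand, kernel_ofReal, kernel_eq_psum, bkernel, sqNorm_of_lt (norm_inner_lt_one hz hw)]
  push_cast
  rw [div_eq_mul_inv]

theorem bkernel_nonneg (hn : 1 ≤ n) (ha : -1 < a) (hb : -(n : ℝ) < b)
    (z w : EuclideanSpace ℂ (Fin n)) : 0 ≤ bkernel n a b z w := by
  refine mul_nonneg (sqNorm_nonneg _ _) (inv_nonneg.2 (tsum_nonneg fun k => ?_))
  exact mul_nonneg (kcoef_pos hn ha hb k).le (by positivity)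

theorem measurable_kreal (n : ℕ) (a b : ℝ) : Measurable (kreal n a b) := by
  unfold kreal
  exact Measurable.tsum fun k => by fun_prop

theorem measurable_bkernel (hn : 1 ≤ n) (ha : -1 < a) (hb : -(n : ℝ) < b) :
    Measurable (fun q : EuclideanSpace ℂ (Fin n) × EuclideanSpace ℂ (Fin n) =>
      bkernel n a b q.1 q.2) := by
  have h1 := measurable_sqNorm (isDiskSeries_kcoef hn ha hb)
  have h2 := measurable_kreal n a b
  unfold bkernel
  fun_prop

/-- The integral is a power series in `|z|²` with coefficients of size `(k+1)^(σ-1)`, `σ =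
n+1+2a-t`; positivity of `σ` is what the binomial comparison requires. -/
theorem exists_lintegral_sqNorm_mul_wt_le (hn : 1 ≤ n) (ha : -1 < a) (hb : -(n : ℝ) < b) {s t : ℝ}
    (hs : -(n : ℝ) < s) (ht : -1 < t) (hat : 0 < n + 1 + 2 * a - t) :
    ∃ C : ℝ, 0 < C ∧ ∀ z : EuclideanSpace ℂ (Fin n), ‖z‖ < 1 →
      ∫⁻ w, ENNReal.ofReal (sqNorm (kcoef n a b) (inner ℂ z w)) * ENNReal.ofReal (wt s t w)
        ∂volBall n ≤ ENNReal.ofReal (C * (1 - ‖z‖ ^ 2) ^ (-(n + 1 + 2 * a - t))) := by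
  obtain ⟨C, hC, h⟩ := exists_lintegral_sqNorm_inner_mul_wt hn
  have hnn : ∀ k : ℕ, 0 ≤ kcoef n a b k ^ 2 * (k.factorial / Real.Gamma (k + n)) *
      ProbabilityTheory.beta (k + (n + s)) (t + 1) := fun k => by
    have hn' : (0 : ℝ) < n := by exact_mod_cast hn
    have hk : (0 : ℝ) ≤ k := k.cast_nonneg
    have h1 := Real.Gamma_pos_of_pos (by linarith : 0 < k + (n : ℝ))
    have h2 := ProbabilityTheory.beta_pos (by linarith : 0 < k + (n + s)) (by linarith : 0 < t + 1)
    positivity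
  obtain ⟨M, hM0, hM⟩ := exists_tsum_mul_pow_le hat hnn (sq_kcoef_mul_beta_isTheta hn ha hb hs ht).1
  refine ⟨C * M, by positivity, fun z hz => ?_⟩
  obtain ⟨h1, h2⟩ := hM (‖z‖ ^ 2) (by positivity) (sq_norm_lt_one hz)
  rw [h _ (isDiskSeries_kcoef hn ha hb) z s t hz hs ht, ← ENNReal.ofReal_tsum_of_nonneg
    (fun k => mul_nonneg hC.le (mul_nonneg (hnn k) (by positivity))) (h1.mul_left C), tsum_mul_left]
  refine ENNReal.ofReal_le_ofReal ?_
  rw [mul_assoc]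
  exact mul_le_mul_of_nonneg_left h2 hC.le

theorem wt_pos {s t : ℝ} {w : EuclideanSpace ℂ (Fin n)} (hw : ‖w‖ < 1) (hw0 : w ≠ 0) :
    0 < wt s t w := by
  have h1 : 0 < ‖w‖ := norm_pos_iff.2 hw0
  have h2 : 0 < 1 - ‖w‖ ^ 2 := by linarith [sq_norm_lt_one hw]
  exact mul_pos (Real.rpow_pos_of_pos h1 _) (Real.rpow_pos_of_pos h2 _)

theorem wt_nonneg {s t : ℝ} {w : EuclideanSpace ℂ (Fin n)} (hw : ‖w‖ < 1) : 0 ≤ wt s t w := by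
  have h2 : 0 < 1 - ‖w‖ ^ 2 := by linarith [sq_norm_lt_one hw]
  exact mul_nonneg (Real.rpow_nonneg (norm_nonneg _) _) (Real.rpow_nonneg h2.le _)

theorem wt_mul_one_sub {s t r : ℝ} {w : EuclideanSpace ℂ (Fin n)} (hw : ‖w‖ < 1) :
    wt s t w * (1 - ‖w‖ ^ 2) ^ r = wt s (t + r) w := by
  have h2 : 0 < 1 - ‖w‖ ^ 2 := by linarith [sq_norm_lt_one hw]
  rw [wt, wt, mul_assoc, ← Real.rpow_add h2]

/-- The factor `1/𝒦(|z|²)` is constant in `w` and contributes `(1-|z|²)^(n+a+1)`, which turns the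
exponent `-(n+1+2a-t)` into `t - a`. -/
theorem exists_lintegral_bkernel_right_le (hn : 1 ≤ n) (ha : -1 < a) (hb : -(n : ℝ) < b) {s t : ℝ}
    (hs : -(n : ℝ) < s) (ht : -1 < t) (hat : 0 < n + 1 + 2 * a - t) :
    ∃ C : ℝ, 0 < C ∧ ∀ z : EuclideanSpace ℂ (Fin n), ‖z‖ < 1 →
      ∫⁻ w, ENNReal.ofReal (bkernel n a b z w) * ENNReal.ofReal (wt s t w) ∂volBall n ≤
        ENNReal.ofReal (C * (1 - ‖z‖ ^ 2) ^ (t - a)) := by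
  obtain ⟨C, hC, h⟩ := exists_lintegral_sqNorm_mul_wt_le hn ha hb hs ht hat
  obtain ⟨M, hM0, hM⟩ := exists_inv_kreal_le hn ha hb
  refine ⟨M * C, by positivity, fun z hz => ?_⟩
  have hz' := sq_norm_lt_one hz
  have hz2 : 0 < 1 - ‖z‖ ^ 2 := by linarith
  have hk := one_le_kreal hn ha hb (by positivity) hz'
  have e : ∀ w, ENNReal.ofReal (bkernel n a b z w) * ENNReal.ofReal (wt s t w) =
      ENNReal.ofReal (kreal n a b (‖z‖ ^ 2))⁻¹ *
        (ENNReal.ofReal (sqNorm (kcoef n a b) (inner ℂ z w)) * ENNReal.ofReal (wt s t w)) :=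
    fun w => by
      rw [bkernel, mul_comm (sqNorm _ _), ENNReal.ofReal_mul (by positivity), mul_assoc]
  simp_rw [e]
  rw [lintegral_const_mul' _ _ ENNReal.ofReal_ne_top]
  refine (mul_le_mul' (ENNReal.ofReal_le_ofReal (hM _ (by positivity) hz')) (h z hz)).trans ?_
  rw [← ENNReal.ofReal_mul (by positivity), mul_mul_mul_comm, ← Real.rpow_add hz2]
  refine le_of_eq ?_
  congr 3; ring

/-- Here `1/𝒦(|z|²)` lies under the integral and is absorbed into the weight, raising its exponent
from `t` to `t+n+a+1`. The same integral estimate then applies exactly when `t < a`. -/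
theorem exists_lintegral_bkernel_left_le (hn : 1 ≤ n) (ha : -1 < a) (hb : -(n : ℝ) < b) {s t : ℝ}
    (hs : -(n : ℝ) < s) (ht : -1 < t + (n + a + 1)) (hat : t < a) :
    ∃ C : ℝ, 0 < C ∧ ∀ w : EuclideanSpace ℂ (Fin n), ‖w‖ < 1 →
      ∫⁻ z, ENNReal.ofReal (bkernel n a b z w) * ENNReal.ofReal (wt s t z) ∂volBall n ≤
        ENNReal.ofReal (C * (1 - ‖w‖ ^ 2) ^ (t - a)) := by
  obtain ⟨C, hC, h⟩ := exists_lintegral_sqNorm_mul_wt_le hn ha hb hs ht (by linarith)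
  obtain ⟨M, hM0, hM⟩ := exists_inv_kreal_le hn ha hb
  refine ⟨M * C, by positivity, fun w hw => ?_⟩
  have hw2 : 0 < 1 - ‖w‖ ^ 2 := by linarith [sq_norm_lt_one hw]
  calc ∫⁻ z, ENNReal.ofReal (bkernel n a b z w) * ENNReal.ofReal (wt s t z) ∂volBall n
      ≤ ∫⁻ z, ENNReal.ofReal M * (ENNReal.ofReal (sqNorm (kcoef n a b) (inner ℂ w z)) *
          ENNReal.ofReal (wt s (t + (n + a + 1)) z)) ∂volBall n := by
        refine lintegral_mono_ae ?_
        filter_upwards [ae_volBall] with z hz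
        have hz' := sq_norm_lt_one hz
        have hs0 := sqNorm_nonneg (kcoef n a b) (inner ℂ z w)
        rw [sqNorm_inner_comm, ← ENNReal.ofReal_mul (bkernel_nonneg hn ha hb _ _),
          ← ENNReal.ofReal_mul hs0, ← ENNReal.ofReal_mul hM0.le, ← wt_mul_one_sub hz, bkernel]
        refine ENNReal.ofReal_le_ofReal ?_
        have h3 := mul_le_mul_of_nonneg_left (hM _ (by positivity) hz')
          (mul_nonneg hs0 (wt_nonneg (s := s) (t := t) hz))
        linarith
    _ ≤ _ := by
        rw [lintegral_const_mul' _ _ ENNReal.ofReal_ne_top]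
        refine (mul_le_mul_right (h w hw) _).trans ?_
        rw [← ENNReal.ofReal_mul hM0.le]
        refine ENNReal.ofReal_le_ofReal (le_of_eq ?_)
        rw [← mul_assoc]
        congr 2; ring

end Estimates

/-! ### Schur's test -/

section Schur

variable {X : Type*} [MeasurableSpace X] {μ : Measure X} {κ : X → X → ℝ≥0∞}
  {U V h : X → ℝ≥0∞} {p q : ℝ} {A B : ℝ≥0∞}

/-- The second half of Schur's test: a pointwise bound by a weighted integral of `g ^ p` together
with a bound for the transposed kernel gives an `L^p` estimate. -/
theorem lintegral_rpow_le_of_pointwise [SFinite μ] (hκ : Measurable (Function.uncurry κ)) (hU : Measurable U)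
    (hV : Measurable V) (hh : Measurable h)
    (hpos : ∀ᵐ x ∂μ, h x ≠ 0 ∧ h x ≠ ∞)
    (hp : 0 < p) {g : X → ℝ≥0∞} (hg : Measurable g)
    (h1 : ∀ᵐ z ∂μ, (∫⁻ w, g w * κ z w * V w ∂μ) ^ p ≤
      A * h z ^ p * ∫⁻ w, (g w * (h w)⁻¹) ^ p * κ z w * V w ∂μ)
    (h2 : ∀ᵐ w ∂μ, V w * ∫⁻ z, κ z w * (h z ^ p * U z) ∂μ ≤ B * (h w ^ p * U w)) :
    ∫⁻ z, (∫⁻ w, g w * κ z w * V w ∂μ) ^ p * U z ∂μ ≤ A * B * ∫⁻ w, g w ^ p * U w ∂μ := by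
  have hκ' : Measurable fun q : X × X => κ q.1 q.2 := hκ
  calc ∫⁻ z, (∫⁻ w, g w * κ z w * V w ∂μ) ^ p * U z ∂μ
      ≤ ∫⁻ z, ∫⁻ w, A * ((g w * (h w)⁻¹) ^ p * V w * (κ z w * (h z ^ p * U z))) ∂μ ∂μ := by
        refine lintegral_mono_ae ?_
        filter_upwards [h1] with z hz
        -- After the pointwise bound, Tonelli brings the column integral in `z` inside, and the
        -- power of `h` it produces cancels `(h w)⁻¹ ^ p`.
        refine (mul_le_mul_left hz _).trans (le_of_eq ?_)
        rw [mul_assoc, mul_comm _ (U z), ← lintegral_const_mul _ (by fun_prop),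
          ← lintegral_const_mul _ (by fun_prop)]
        refine lintegral_congr fun w => ?_
        ring
    _ = ∫⁻ w, A * ((g w * (h w)⁻¹) ^ p * (V w * ∫⁻ z, κ z w * (h z ^ p * U z) ∂μ)) ∂μ := by
        rw [lintegral_lintegral_swap (by fun_prop)]
        refine lintegral_congr fun w => ?_
        rw [lintegral_const_mul _ (by fun_prop), lintegral_const_mul _ (by fun_prop), mul_assoc]
    _ ≤ ∫⁻ w, A * B * (g w ^ p * U w) ∂μ := by
        refine lintegral_mono_ae ?_
        filter_upwards [h2, hpos] with w hw hw0
        rw [mul_assoc A B]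
        refine mul_le_mul_right ?_ _
        refine (mul_le_mul_right hw _).trans (le_of_eq ?_)
        have : h w ^ p ≠ 0 := by simp [ENNReal.rpow_eq_zero_iff, hw0.1, hw0.2]
        have h' : h w ^ p ≠ ∞ := by simp [ENNReal.rpow_eq_top_iff, hw0.1, hw0.2]
        rw [ENNReal.mul_rpow_of_nonneg _ _ hp.le, ENNReal.inv_rpow]
        calc g w ^ p * (h w ^ p)⁻¹ * (B * (h w ^ p * U w)) =
            ((h w ^ p)⁻¹ * h w ^ p) * (B * (g w ^ p * U w)) := by ring
          _ = _ := by rw [ENNReal.inv_mul_cancel this h', one_mul]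
    _ = _ := by rw [lintegral_const_mul _ (by fun_prop)]

/-- The first half of Schur's test, by Hölder's inequality. -/
theorem lintegral_mul_rpow_le_of_holder (hκ : Measurable (Function.uncurry κ))
    (hV : Measurable V) (hh : Measurable h)
    (hpos : ∀ᵐ x ∂μ, h x ≠ 0 ∧ h x ≠ ∞)
    (hpq : p.HolderConjugate q) {g : X → ℝ≥0∞} (hg : Measurable g) {z : X}
    (h1 : ∫⁻ w, κ z w * (h w ^ q * V w) ∂μ ≤ A * h z ^ q) :
    (∫⁻ w, g w * κ z w * V w ∂μ) ^ p ≤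
      A ^ (p - 1) * h z ^ p * ∫⁻ w, (g w * (h w)⁻¹) ^ p * κ z w * V w ∂μ := by
  have hκz : Measurable (κ z) := hκ.of_uncurry_left
  have hp := hpq.pos
  have hq := hpq.symm.pos
  -- Hölder is applied to `g = (g / h) * h` in the measure `κ z w * V w ∂μ`.
  set ν := μ.withDensity (fun w => κ z w * V w) with hν
  have hd : Measurable fun w => κ z w * V w := by fun_prop
  have e1 : ∫⁻ w, g w * κ z w * V w ∂μ = ∫⁻ w, (g w * (h w)⁻¹) * h w ∂ν := by
    rw [hν, lintegral_withDensity_eq_lintegral_mul _ hd (by fun_prop)]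
    refine lintegral_congr_ae ?_
    filter_upwards [hpos] with w hw
    simp only [Pi.mul_apply]
    rw [mul_assoc (g w) (h w)⁻¹, ENNReal.inv_mul_cancel hw.1 hw.2]
    ring
  have e2 : ∫⁻ w, (g w * (h w)⁻¹) ^ p * κ z w * V w ∂μ = ∫⁻ w, (g w * (h w)⁻¹) ^ p ∂ν := by
    rw [hν, lintegral_withDensity_eq_lintegral_mul _ hd (by fun_prop)]
    refine lintegral_congr fun w => ?_
    simp only [Pi.mul_apply]; ring
  have e3 : ∫⁻ w, κ z w * (h w ^ q * V w) ∂μ = ∫⁻ w, h w ^ q ∂ν := by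
    rw [hν, lintegral_withDensity_eq_lintegral_mul _ hd (by fun_prop)]
    refine lintegral_congr fun w => ?_
    simp only [Pi.mul_apply]; ring
  have hH := ENNReal.lintegral_mul_le_Lp_mul_Lq ν hpq
    (f := fun w => g w * (h w)⁻¹) (g := h) (by fun_prop) (by fun_prop)
  simp only [Pi.mul_apply] at hH
  rw [e1, e2]
  refine (ENNReal.rpow_le_rpow hH hp.le).trans ?_
  rw [ENNReal.mul_rpow_of_nonneg _ _ hp.le, ← ENNReal.rpow_mul, ← ENNReal.rpow_mul,
    one_div_mul_cancel hp.ne', ENNReal.rpow_one, mul_comm]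
  refine mul_le_mul_left ?_ _
  have hpq' : 1 / q * p = p - 1 := by
    have := hpq.div_conj_eq_sub_one
    rw [← this]; ring
  rw [e3] at h1
  refine (ENNReal.rpow_le_rpow h1 (by positivity)).trans (le_of_eq ?_)
  rw [ENNReal.mul_rpow_of_nonneg _ _ (by positivity), ← ENNReal.rpow_mul]
  congr 2
  · field_simp

end Schur

/-! ### The measures -/

section Measures

variable {n : ℕ} {a b c d : ℝ}

/-- The normalizing constant of `μ_{a,b}`. -/
noncomputable def muConst (n : ℕ) (a b : ℝ) : ℝ :=
  ((n - 1).factorial : ℝ) / (Real.pi ^ n * ProbabilityTheory.beta (a + 1) (b + n))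

theorem muConst_pos (ha : -1 < a) (hb : -(n : ℝ) < b) : 0 < muConst n a b := by
  have := ProbabilityTheory.beta_pos (by linarith : 0 < a + 1) (by linarith : 0 < b + n)
  unfold muConst
  positivity

/-- The density of `μ_{a,b}` with respect to Lebesgue measure on the ball. -/
noncomputable def dens (n : ℕ) (a b : ℝ) (w : EuclideanSpace ℂ (Fin n)) : ℝ≥0∞ :=
  ENNReal.ofReal (muConst n a b) * ENNReal.ofReal (wt b a w)

@[fun_prop]
theorem measurable_dens : Measurable (dens n a b) := by unfold dens; fun_prop

theorem mu_eq (ha : -1 < a) (hb : -(n : ℝ) < b) :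
    mu n a b = (volBall n).withDensity (dens n a b) := by
  unfold mu volBall dens
  congr 1
  funext w
  rw [← ENNReal.ofReal_mul (muConst_pos ha hb).le]
  rfl

theorem lintegral_mu (ha : -1 < a) (hb : -(n : ℝ) < b) {f : EuclideanSpace ℂ (Fin n) → ℝ≥0∞}
    (hf : Measurable f) : ∫⁻ w, f w ∂mu n a b = ∫⁻ w, f w * dens n a b w ∂volBall n := by
  rw [mu_eq ha hb, lintegral_withDensity_eq_lintegral_mul _ measurable_dens hf]
  exact lintegral_congr fun w => mul_comm _ _

theorem ae_ne_zero (hn : 1 ≤ n) : ∀ᵐ w ∂volBall n, w ≠ 0 := by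
  have hnt : Nontrivial (EuclideanSpace ℂ (Fin n)) :=
    Module.nontrivial_of_finrank_pos (R := ℝ) (by rw [finrank_real_euclideanSpace_complex]; omega)
  have : ∀ᵐ w : EuclideanSpace ℂ (Fin n), w ≠ 0 := Measure.ae_ne volume 0
  exact ae_restrict_of_ae this

/-- The density is positive on the ball away from the origin, which is a null set since `n ≥ 1`.
Hence all the measures `μ_{a,b}` have the same null sets. -/
theorem ae_mu_iff (hn : 1 ≤ n) (ha : -1 < a) (hb : -(n : ℝ) < b)
    {P : EuclideanSpace ℂ (Fin n) → Prop} :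
    (∀ᵐ w ∂mu n a b, P w) ↔ ∀ᵐ w ∂volBall n, P w := by
  rw [mu_eq ha hb, ae_withDensity_iff measurable_dens]
  refine ⟨fun h => ?_, fun h => h.mono fun w hw _ => hw⟩
  filter_upwards [h, ae_volBall, ae_ne_zero hn] with w hw h1 h2
  refine hw (mul_ne_zero ?_ ?_)
  · simpa using muConst_pos ha hb
  · simpa using wt_pos h1 h2

theorem mu_absolutelyContinuous (hn : 1 ≤ n) (ha : -1 < a) (hb : -(n : ℝ) < b) (hc : -1 < c)
    (hd : -(n : ℝ) < d) : mu n a b ≪ mu n c d := by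
  refine Measure.ae_le_iff_absolutelyContinuous.1 fun s hs => ?_
  exact (ae_mu_iff hn ha hb).2 ((ae_mu_iff hn hc hd).1 hs)

theorem sFinite_mu : SFinite (mu n a b) := by
  unfold mu; infer_instance

end Measures

/-! ### The sufficient condition -/

section Sufficiency

variable {n : ℕ} {a b c d p : ℝ}

theorem wt_rpow {s t r : ℝ} {w : EuclideanSpace ℂ (Fin n)} (hw : ‖w‖ < 1) :
    wt s t w ^ r = wt (r * s) (r * t) w := by
  have h2 : 0 < 1 - ‖w‖ ^ 2 := by linarith [sq_norm_lt_one hw]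
  rw [wt, wt, Real.mul_rpow (Real.rpow_nonneg (norm_nonneg _) _) (Real.rpow_nonneg h2.le _),
    ← Real.rpow_mul (norm_nonneg _), ← Real.rpow_mul h2.le]
  congr 2 <;> ring

theorem wt_mul_wt {s t s' t' : ℝ} {w : EuclideanSpace ℂ (Fin n)} (hw : ‖w‖ < 1) (hw0 : w ≠ 0) :
    wt s t w * wt s' t' w = wt (s + s') (t + t') w := by
  have h1 : 0 < ‖w‖ := norm_pos_iff.2 hw0
  have h2 : 0 < 1 - ‖w‖ ^ 2 := by linarith [sq_norm_lt_one hw]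
  rw [wt, wt, wt, mul_mul_mul_comm, ← Real.rpow_add h1, ← Real.rpow_add h2]
  congr 2; ring

theorem wt_le_wt {s s' t : ℝ} (hs : s' ≤ s) {w : EuclideanSpace ℂ (Fin n)} (hw : ‖w‖ < 1)
    (hw0 : w ≠ 0) : wt s t w ≤ wt s' t w := by
  have h1 : 0 < ‖w‖ := norm_pos_iff.2 hw0
  have h2 : 0 < 1 - ‖w‖ ^ 2 := by linarith [sq_norm_lt_one hw]
  exact mul_le_mul_of_nonneg_right
    (Real.rpow_le_rpow_of_exponent_ge h1 hw.le (by linarith)) (Real.rpow_nonneg h2.le _)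

/-- Schur's row condition for a radial weight. -/
theorem exists_row_bound (hn : 1 ≤ n) (ha : -1 < a) (hb : -(n : ℝ) < b) {s t : ℝ}
    (hs : s ≤ 0) (hs' : -(n : ℝ) < b + s) (ht : -1 < a + t) (ht' : t < n + 1 + a) :
    ∃ A : ℝ≥0, ∀ᵐ z ∂volBall n,
      ∫⁻ w, ENNReal.ofReal (bkernel n a b z w) * (ENNReal.ofReal (wt s t w) * dens n a b w)
        ∂volBall n ≤ A * ENNReal.ofReal (wt s t z) := by
  obtain ⟨C, hC, h⟩ := exists_lintegral_bkernel_right_le hn ha hb hs' ht (by linarith)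
  have hm := muConst_pos ha hb
  refine ⟨(muConst n a b * C).toNNReal, ?_⟩
  filter_upwards [ae_volBall, ae_ne_zero hn] with z hz hz0
  have hz2 : 0 < 1 - ‖z‖ ^ 2 := by linarith [sq_norm_lt_one hz]
  calc _ = ∫⁻ w, ENNReal.ofReal (muConst n a b) * (ENNReal.ofReal (bkernel n a b z w) *
        ENNReal.ofReal (wt (b + s) (a + t) w)) ∂volBall n := by
        refine lintegral_congr_ae ?_
        filter_upwards [ae_volBall, ae_ne_zero hn] with w hw hw0
        rw [← wt_mul_wt hw hw0, ENNReal.ofReal_mul (wt_nonneg hw), dens]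
        ring
    _ ≤ ENNReal.ofReal (muConst n a b) * ENNReal.ofReal (C * (1 - ‖z‖ ^ 2) ^ t) := by
        rw [lintegral_const_mul' _ _ ENNReal.ofReal_ne_top]
        have := h z hz
        rw [add_sub_cancel_left] at this
        exact mul_le_mul_right this _
    _ ≤ _ := by
        rw [← ENNReal.ofReal_mul hm.le, ← ENNReal.ofReal, ← ENNReal.ofReal_mul (by positivity),
          mul_assoc]
        refine ENNReal.ofReal_le_ofReal ?_
        gcongr
        -- The row integral stays bounded near the origin; `s ≤ 0` gives `|z|^(2s) ≥ 1`, so the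
        -- weight dominates it there.
        have := wt_le_wt (t := t) hs hz hz0
        rwa [wt, mul_zero, Real.rpow_zero, one_mul] at this

/-- Schur's column condition for a radial weight. -/
theorem exists_column_bound (hn : 1 ≤ n) (ha : -1 < a) (hb : -(n : ℝ) < b) (hc : -1 < c)
    (hd : -(n : ℝ) < d) {s t : ℝ}
    (hs : -(n : ℝ) < d + s) (hs' : d + s ≤ b) (ht : -1 < c + t + (n + a + 1)) (ht' : c + t < a) :
    ∃ B : ℝ≥0, ∀ᵐ w ∂volBall n,
      dens n a b w * ∫⁻ z, ENNReal.ofReal (bkernel n a b z w) *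
        (ENNReal.ofReal (wt s t z) * dens n c d z) ∂volBall n ≤
        B * (ENNReal.ofReal (wt s t w) * dens n c d w) := by
  obtain ⟨C, hC, h⟩ := exists_lintegral_bkernel_left_le hn ha hb hs ht ht'
  have hm := muConst_pos ha hb
  have hm' := muConst_pos hc hd
  refine ⟨(muConst n a b * C).toNNReal, ?_⟩
  filter_upwards [ae_volBall, ae_ne_zero hn] with w hw hw0
  have hw2 : 0 < 1 - ‖w‖ ^ 2 := by linarith [sq_norm_lt_one hw]
  calc _ = dens n a b w * ∫⁻ z, ENNReal.ofReal (muConst n c d) *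
        (ENNReal.ofReal (bkernel n a b z w) *
        ENNReal.ofReal (wt (d + s) (c + t) z)) ∂volBall n := by
        congr 1
        refine lintegral_congr_ae ?_
        filter_upwards [ae_volBall, ae_ne_zero hn] with z hz hz0
        rw [← wt_mul_wt hz hz0, ENNReal.ofReal_mul (wt_nonneg hz), dens]
        ring
    _ ≤ dens n a b w * (ENNReal.ofReal (muConst n c d) *
        ENNReal.ofReal (C * (1 - ‖w‖ ^ 2) ^ (c + t - a))) := by
        rw [lintegral_const_mul' _ _ ENNReal.ofReal_ne_top]
        exact mul_le_mul_right (mul_le_mul_right (h w hw) _) _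
    _ ≤ _ := by
        have hwt : ∀ s t, 0 ≤ wt s t w := fun s t => wt_nonneg hw
        rw [dens, dens, ← ENNReal.ofReal, ← ENNReal.ofReal_mul hm.le, ← ENNReal.ofReal_mul hm'.le,
          ← ENNReal.ofReal_mul hm'.le, ← ENNReal.ofReal_mul (hwt _ _),
          ← ENNReal.ofReal_mul (mul_nonneg hm.le (hwt _ _)), ← ENNReal.ofReal_mul (by positivity)]
        refine ENNReal.ofReal_le_ofReal ?_
        -- The powers of `1-|w|²` agree, and `d + s ≤ b` compares the powers of `|w|`.
        have h1 : wt b a w * (1 - ‖w‖ ^ 2) ^ (c + t - a) ≤ wt s t w * wt d c w := by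
          rw [wt_mul_one_sub hw, wt_mul_wt hw hw0, add_comm s, add_comm t, add_sub_cancel]
          exact wt_le_wt hs' hw hw0
        calc _ = muConst n a b * C * muConst n c d *
              (wt b a w * (1 - ‖w‖ ^ 2) ^ (c + t - a)) := by ring
          _ ≤ muConst n a b * C * muConst n c d * (wt s t w * wt d c w) := by gcongr
          _ = _ := by ring

/-- The `L^p` estimate for the Berezin transform of nonnegative functions. -/
theorem exists_lintegral_bkernel_rpow_le (hn : 1 ≤ n) (ha : -1 < a) (hb : -(n : ℝ) < b)
    (hc : -1 < c) (hd : -(n : ℝ) < d) (hp : 1 ≤ p) (h1 : c + 1 < p * (a + 1))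
    (h2 : 1 < p → d + n < p * (b + n)) (h3 : p = 1 → d ≤ b) :
    ∃ C : ℝ≥0, ∀ g : EuclideanSpace ℂ (Fin n) → ℝ≥0∞, Measurable g →
      ∫⁻ z, (∫⁻ w, g w * ENNReal.ofReal (bkernel n a b z w) ∂mu n a b) ^ p ∂mu n c d ≤
        C * ∫⁻ w, g w ^ p ∂mu n c d := by
  have hκ : Measurable (Function.uncurry fun z w : EuclideanSpace ℂ (Fin n) =>
      ENNReal.ofReal (bkernel n a b z w)) := (measurable_bkernel hn ha hb).ennreal_ofReal
  have hκ' : Measurable fun q : EuclideanSpace ℂ (Fin n) × EuclideanSpace ℂ (Fin n) =>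
      ENNReal.ofReal (bkernel n a b q.1 q.2) := hκ
  have hκz : ∀ z : EuclideanSpace ℂ (Fin n),
      Measurable fun w => ENNReal.ofReal (bkernel n a b z w) := fun z => hκ.of_uncurry_left
  have hp0 : 0 < p := by linarith
  have hn0 : (0 : ℝ) < n := by exact_mod_cast hn
  suffices H : ∃ C : ℝ≥0, ∀ g : EuclideanSpace ℂ (Fin n) → ℝ≥0∞, Measurable g →
      ∫⁻ z, (∫⁻ w, g w * ENNReal.ofReal (bkernel n a b z w) * dens n a b w ∂volBall n) ^ p *
        dens n c d z ∂volBall n ≤ C * ∫⁻ w, g w ^ p * dens n c d w ∂volBall n by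
    obtain ⟨C, hC⟩ := H
    refine ⟨C, fun g hg => ?_⟩
    have e : ∀ z, ∫⁻ w, g w * ENNReal.ofReal (bkernel n a b z w) ∂mu n a b =
        ∫⁻ w, g w * ENNReal.ofReal (bkernel n a b z w) * dens n a b w ∂volBall n := fun z =>
      lintegral_mu ha hb (hg.mul (hκz z))
    simp_rw [e]
    rw [lintegral_mu hc hd (by fun_prop), lintegral_mu hc hd (by fun_prop)]
    exact hC g hg
  rcases hp.eq_or_lt with rfl | hp1
  -- For `p = 1` the weight `h = 1` suffices and only columns matter; the column bound with `s = t =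
  -- 0` asks for `d ≤ b` and `c < a`.
  · obtain ⟨B, hB⟩ := exists_column_bound hn ha hb hc hd (s := 0) (t := 0)
      (by linarith) (by linarith [h3 rfl]) (by linarith) (by linarith)
    refine ⟨B, fun g hg => ?_⟩
    have := lintegral_rpow_le_of_pointwise (μ := volBall n) (h := fun _ => 1) (p := 1)
      (A := 1) (B := B) (U := dens n c d) (V := dens n a b) hκ (by fun_prop) (by fun_prop)
      (by fun_prop) (by simp) one_pos hg (by simp) (by
        filter_upwards [hB] with w hw
        simpa [wt] using hw)
    simpa using this
  · have hd' := h2 hp1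
    set q := p.conjExponent with hq
    have hpq : p.HolderConjugate q := Real.HolderConjugate.conjExponent hp1
    have hq0 : 0 < q := hpq.symm.pos
    have hp1' : 0 < p - 1 := by linarith
    have hqv : ∀ x, q * -(x / p) = -(x / (p - 1)) := fun x => by
      rw [hq, Real.conjExponent]; field_simp
    have hpv : ∀ x, p * -(x / p) = -x := fun x => by field_simp
    -- Boundary exponent: the row test requires `-(n+1+a) < u/(p-1) < a+1`, the column test `c-a < u
    -- < c+n+a+2`. These intervals meet because `c+1 < p(a+1)`.
    obtain ⟨u, hu1, hu2⟩ : ∃ u, max (c - a) (-((p - 1) * (n + 1 + a))) < u ∧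
        u < min ((p - 1) * (a + 1)) (c + n + a + 2) := by
      have e1 : 0 < (p - 1) * (n + 1 + a) := mul_pos hp1' (by linarith)
      have e2 : 0 < (p - 1) * (a + 1) := mul_pos hp1' (by linarith)
      exact exists_between (max_lt (lt_min (by linarith) (by linarith))
        (lt_min (by linarith) (by linarith)))
    obtain ⟨hu3, hu4⟩ := max_lt_iff.1 hu1
    obtain ⟨hu5, hu6⟩ := lt_min_iff.1 hu2
    -- Exponent at the origin: rows need `0 ≤ v < (p-1)(b+n)`, columns `d-b ≤ v < d+n`. These are
    -- compatible because `d+n < p(b+n)`.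
    obtain ⟨v, hv0, hv1, hv2, hv3⟩ : ∃ v : ℝ, 0 ≤ v ∧ d - b ≤ v ∧ v < (p - 1) * (b + n) ∧
        v < d + n := by
      have e2 : 0 < (p - 1) * (b + n) := mul_pos hp1' (by linarith)
      exact ⟨max 0 (d - b), le_max_left _ _, le_max_right _ _,
        max_lt e2 (by linarith), max_lt (by linarith) (by linarith)⟩
    have hu7 : u / (p - 1) < a + 1 := by rw [div_lt_iff₀ hp1']; linarith
    have hu8 : -(n + 1 + a) < u / (p - 1) := by rw [lt_div_iff₀ hp1']; linarith
    have hv4 : v / (p - 1) < b + n := by rw [div_lt_iff₀ hp1']; linarith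
    have hv5 : 0 ≤ v / (p - 1) := by positivity
    obtain ⟨A, hA⟩ := exists_row_bound hn ha hb (s := q * -(v / p)) (t := q * -(u / p))
      (by rw [hqv]; linarith) (by rw [hqv]; linarith) (by rw [hqv]; linarith)
      (by rw [hqv]; linarith)
    obtain ⟨B, hB⟩ := exists_column_bound hn ha hb hc hd (s := p * -(v / p)) (t := p * -(u / p))
      (by rw [hpv]; linarith) (by rw [hpv]; linarith) (by rw [hpv]; linarith)
      (by rw [hpv]; linarith)
    let h : EuclideanSpace ℂ (Fin n) → ℝ≥0∞ := fun w => ENNReal.ofReal (wt (-(v / p)) (-(u / p)) w)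
    have hh : Measurable h := by fun_prop
    have hpow : ∀ r : ℝ, 0 ≤ r → ∀ w : EuclideanSpace ℂ (Fin n), ‖w‖ < 1 →
        h w ^ r = ENNReal.ofReal (wt (r * -(v / p)) (r * -(u / p)) w) := fun r hr w hw => by
      rw [ENNReal.ofReal_rpow_of_nonneg (wt_nonneg hw) hr, wt_rpow hw]
    have hpos : ∀ᵐ w ∂volBall n, h w ≠ 0 ∧ h w ≠ ∞ := by
      filter_upwards [ae_volBall, ae_ne_zero hn] with w hw hw0
      exact ⟨by simpa [h] using wt_pos hw hw0, ENNReal.ofReal_ne_top⟩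
    refine ⟨A ^ (p - 1) * B, fun g hg => ?_⟩
    have key := lintegral_rpow_le_of_pointwise (μ := volBall n) (h := h) (p := p)
      (A := (A : ℝ≥0∞) ^ (p - 1)) (B := B) (U := dens n c d) (V := dens n a b) hκ (by fun_prop)
      (by fun_prop) hh hpos hp0 hg (by
        filter_upwards [hA, ae_volBall] with z hz hz1
        refine lintegral_mul_rpow_le_of_holder hκ (by fun_prop) hh hpos hpq hg ?_
        rw [hpow q hq0.le z hz1]
        refine le_trans (le_of_eq (lintegral_congr_ae ?_)) hz
        filter_upwards [ae_volBall] with w hw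
        rw [hpow q hq0.le w hw]) (by
        filter_upwards [hB, ae_volBall] with w hw hw1
        rw [hpow p hp0.le w hw1]
        refine le_trans (le_of_eq ?_) hw
        congr 1
        refine lintegral_congr_ae ?_
        filter_upwards [ae_volBall] with z hz
        rw [hpow p hp0.le z hz])
    rwa [ENNReal.coe_mul, ENNReal.coe_rpow_of_nonneg _ hp1'.le]

theorem eLpNorm_ofReal_eq {α F : Type*} [MeasurableSpace α] [NormedAddCommGroup F] (μ : Measure α)
    (f : α → F) (hp : 0 < p) :
    eLpNorm f (ENNReal.ofReal p) μ = (∫⁻ x, ‖f x‖ₑ ^ p ∂μ) ^ (1 / p) := by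
  rw [eLpNorm_eq_lintegral_rpow_enorm_toReal (by simpa using hp) ENNReal.ofReal_ne_top,
    ENNReal.toReal_ofReal hp.le]

/-- The estimate for `|f|` controls everything: finiteness of its `L^p` norm makes the positive
integral finite almost everywhere, which is absolute convergence, and it dominates the transform of
`f`. -/
theorem berezinBounded_of_lintegral_le (hn : 1 ≤ n) (ha : -1 < a) (hb : -(n : ℝ) < b)
    (hc : -1 < c) (hd : -(n : ℝ) < d) (hp : 0 < p)
    (H : ∃ C : ℝ≥0, ∀ g : EuclideanSpace ℂ (Fin n) → ℝ≥0∞, Measurable g →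
      ∫⁻ z, (∫⁻ w, g w * ENNReal.ofReal (bkernel n a b z w) ∂mu n a b) ^ p ∂mu n c d ≤
        C * ∫⁻ w, g w ^ p ∂mu n c d) :
    BerezinBounded n a b c d p := by
  obtain ⟨C, hC⟩ := H
  have hm := measurable_bkernel (n := n) hn ha hb
  have hmz : ∀ z : EuclideanSpace ℂ (Fin n), Measurable (bkernel n a b z) := fun z => by
    have hm' : Measurable (Function.uncurry (bkernel n a b)) := hm
    exact hm'.of_uncurry_left
  have hsf : SFinite (mu n a b) := sFinite_mu
  refine ⟨C ^ (1 / p), fun f hf => ?_⟩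
  -- A measurable representative for `μ_{c,d}` also represents `f` for `μ_{a,b}`, the null sets
  -- being the same.
  obtain ⟨f', hf'm, hff⟩ := hf.1
  have hff' : f =ᵐ[mu n a b] f' :=
    (mu_absolutelyContinuous hn ha hb hc hd).ae_eq hff
  have hball : ∀ᵐ w ∂mu n a b, ‖w‖ < 1 := (ae_mu_iff hn ha hb).2 ae_volBall
  have hball' : ∀ᵐ w ∂mu n c d, ‖w‖ < 1 := (ae_mu_iff hn hc hd).2 ae_volBall
  have hg : Measurable fun w => ‖f' w‖ₑ := hf'm.measurable.enorm
  let T : EuclideanSpace ℂ (Fin n) → ℝ≥0∞ := fun z =>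
    ∫⁻ w, ‖f' w‖ₑ * ENNReal.ofReal (bkernel n a b z w) ∂mu n a b
  have hTm : Measurable T := by
    refine Measurable.lintegral_prod_right' (f := fun q => ‖f' q.2‖ₑ *
      ENNReal.ofReal (bkernel n a b q.1 q.2)) ?_
    exact (hg.comp measurable_snd).mul hm.ennreal_ofReal
  have hint : ∀ z : EuclideanSpace ℂ (Fin n), ‖z‖ < 1 →
      berezinIntegrand n a b f z =ᵐ[mu n a b] fun w => f' w * (bkernel n a b z w : ℂ) :=
    fun z hz => by
      filter_upwards [hff', hball] with w hw1 hw2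
      rw [berezinIntegrand_eq f hz hw2, hw1]
  have hnorm : ∀ z w : EuclideanSpace ℂ (Fin n), ‖f' w * (bkernel n a b z w : ℂ)‖ₑ =
      ‖f' w‖ₑ * ENNReal.ofReal (bkernel n a b z w) := fun z w => by
    rw [enorm_mul, ← Real.enorm_of_nonneg (bkernel_nonneg hn ha hb z w)]
    congr 1
    simp [enorm_eq_nnnorm]
  have hnormf : ∫⁻ w, ‖f' w‖ₑ ^ p ∂mu n c d = ∫⁻ w, ‖f w‖ₑ ^ p ∂mu n c d :=
    lintegral_congr_ae (by filter_upwards [hff] with w hw; rw [hw])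
  have hTle := hC _ hg
  rw [hnormf] at hTle
  have hfin : ∫⁻ w, ‖f w‖ₑ ^ p ∂mu n c d < ∞ := by
    have := hf.2
    rw [eLpNorm_ofReal_eq _ _ hp] at this
    exact (ENNReal.rpow_lt_top_iff_of_pos (by positivity)).1 this
  have hTfin : ∀ᵐ z ∂mu n c d, T z < ∞ := by
    have h1 : ∫⁻ z, T z ^ p ∂mu n c d ≠ ∞ :=
      (hTle.trans_lt (ENNReal.mul_lt_top ENNReal.coe_lt_top hfin)).ne
    filter_upwards [ae_lt_top (hTm.pow_const p) h1] with z hz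
    exact (ENNReal.rpow_lt_top_iff_of_pos hp).1 hz
  have hberezin : ∀ z : EuclideanSpace ℂ (Fin n), ‖z‖ < 1 →
      berezin n a b f z = ∫ w, f' w * (bkernel n a b z w : ℂ) ∂mu n a b := fun z hz =>
    integral_congr_ae (hint z hz)
  have hle : eLpNorm (berezin n a b f) (ENNReal.ofReal p) (mu n c d) ≤
      (C ^ (1 / p) : ℝ≥0) * eLpNorm f (ENNReal.ofReal p) (mu n c d) := by
    rw [eLpNorm_ofReal_eq _ _ hp, eLpNorm_ofReal_eq _ _ hp,
      ENNReal.coe_rpow_of_nonneg _ (by positivity : 0 ≤ 1 / p),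
      ← ENNReal.mul_rpow_of_nonneg _ _ (by positivity : 0 ≤ 1 / p)]
    refine ENNReal.rpow_le_rpow (le_trans (lintegral_mono_ae ?_) hTle) (by positivity)
    filter_upwards [hball'] with z hz
    refine ENNReal.rpow_le_rpow ?_ hp.le
    rw [hberezin z hz]
    refine (enorm_integral_le_lintegral_enorm _).trans (le_of_eq ?_)
    exact lintegral_congr fun w => hnorm z w
  refine ⟨?_, ⟨?_, hle.trans_lt (ENNReal.mul_lt_top ENNReal.coe_lt_top hf.2)⟩, hle⟩
  · filter_upwards [hball', hTfin] with z hz hz'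
    refine Integrable.congr ⟨?_, ?_⟩ (hint z hz).symm
    · exact (hf'm.measurable.mul (Complex.measurable_ofReal.comp (hmz z))).aestronglyMeasurable
    · rw [HasFiniteIntegral, lintegral_congr (hnorm z)]
      exact hz'
  · have h1 : StronglyMeasurable fun z => ∫ w, f' w * (bkernel n a b z w : ℂ) ∂mu n a b := by
      refine StronglyMeasurable.integral_prod_right' (f := fun q => f' q.2 *
        (bkernel n a b q.1 q.2 : ℂ)) ?_
      exact ((hf'm.measurable.comp measurable_snd).mul
        (Complex.measurable_ofReal.comp hm)).stronglyMeasurable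
    refine h1.aestronglyMeasurable.congr ?_
    filter_upwards [hball'] with z hz using (hberezin z hz).symm

end Sufficiency

/-! ### The necessary condition -/

section Necessity

variable {n : ℕ} {a b c d p : ℝ}

theorem exists_lintegral_wt (hn : 1 ≤ n) :
    ∃ K : ℝ, 0 < K ∧ ∀ s t : ℝ, -(n : ℝ) < s → -1 < t →
      ∫⁻ w, ENNReal.ofReal (wt s t w) ∂volBall n =
        ENNReal.ofReal (K * ProbabilityTheory.beta (n + s) (t + 1)) := by
  obtain ⟨C, hC, h⟩ := exists_lintegral_inner_pow_mul_wt hn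
  have hG := Real.Gamma_pos_of_pos (by exact_mod_cast hn : (0 : ℝ) < n)
  refine ⟨C * (1 / Real.Gamma n), by positivity, fun s t hs ht => ?_⟩
  -- For `k = 0` the factor `‖⟨w, z⟩‖ ^ 0` is `1`, even at `z = 0`.
  simpa using h 0 0 s t hs ht

/-- A bounded Berezin transform satisfies the norm inequality for nonnegative functions. -/
theorem BerezinBounded.exists_lintegral_le (hn : 1 ≤ n) (ha : -1 < a) (hb : -(n : ℝ) < b)
    (hc : -1 < c) (hd : -(n : ℝ) < d) (hp : 0 < p) (H : BerezinBounded n a b c d p) :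
    ∃ C : ℝ≥0, ∀ g : EuclideanSpace ℂ (Fin n) → ℝ, Measurable g → (∀ w, ‖w‖ < 1 → 0 ≤ g w) →
      ∫⁻ w, ENNReal.ofReal (g w) ^ p ∂mu n c d < ∞ →
      ∫⁻ z, (∫⁻ w, ENNReal.ofReal (g w) * ENNReal.ofReal (bkernel n a b z w) ∂mu n a b) ^ p
        ∂mu n c d ≤ C * ∫⁻ w, ENNReal.ofReal (g w) ^ p ∂mu n c d := by
  obtain ⟨C, hC⟩ := H
  refine ⟨C ^ p, fun g hg hg0 hfin => ?_⟩
  have hball : ∀ᵐ w ∂mu n a b, ‖w‖ < 1 := (ae_mu_iff hn ha hb).2 ae_volBall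
  have hball' : ∀ᵐ w ∂mu n c d, ‖w‖ < 1 := (ae_mu_iff hn hc hd).2 ae_volBall
  have hnorm : ∫⁻ w, ‖(g w : ℂ)‖ₑ ^ p ∂mu n c d = ∫⁻ w, ENNReal.ofReal (g w) ^ p ∂mu n c d := by
    refine lintegral_congr_ae ?_
    filter_upwards [hball'] with w hw
    rw [← Real.enorm_of_nonneg (hg0 w hw)]
    simp [enorm_eq_nnnorm]
  have hmem : MemLp (fun w => (g w : ℂ)) (ENNReal.ofReal p) (mu n c d) := by
    refine ⟨(Complex.measurable_ofReal.comp hg).aestronglyMeasurable, ?_⟩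
    rw [eLpNorm_ofReal_eq _ _ hp, hnorm]
    exact ENNReal.rpow_lt_top_of_nonneg (by positivity) hfin.ne
  obtain ⟨h1, -, h3⟩ := hC _ hmem
  rw [eLpNorm_ofReal_eq _ _ hp, eLpNorm_ofReal_eq _ _ hp, hnorm] at h3
  have h4 := ENNReal.rpow_le_rpow h3 hp.le
  rw [ENNReal.mul_rpow_of_nonneg _ _ hp.le, ← ENNReal.rpow_mul, ← ENNReal.rpow_mul,
    one_div_mul_cancel hp.ne', ENNReal.rpow_one, ENNReal.rpow_one,
    ← ENNReal.coe_rpow_of_nonneg _ hp.le] at h4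
  refine le_trans (le_of_eq (lintegral_congr_ae ?_)) h4
  -- Almost everywhere convergence is essential here: the Bochner integral would be `0` at a point
  -- of divergence, and no lower bound would follow.
  filter_upwards [hball', h1] with z hz hz1
  have e : berezinIntegrand n a b (fun w => (g w : ℂ)) z =ᵐ[mu n a b]
      fun w => ((g w * bkernel n a b z w : ℝ) : ℂ) := by
    filter_upwards [hball] with w hw
    rw [berezinIntegrand_eq _ hz hw]
    push_cast; rfl
  have hi : Integrable (fun w => g w * bkernel n a b z w) (mu n a b) := by
    have := (hz1.congr e).re
    simpa using this
  have hnn : 0 ≤ᵐ[mu n a b] fun w => g w * bkernel n a b z w := by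
    filter_upwards [hball] with w hw
    exact mul_nonneg (hg0 w hw) (bkernel_nonneg hn ha hb z w)
  congr 1
  rw [berezin, integral_congr_ae e, integral_complex_ofReal]
  have e2 : ‖((∫ w, g w * bkernel n a b z w ∂mu n a b : ℝ) : ℂ)‖ₑ =
      ENNReal.ofReal (∫ w, g w * bkernel n a b z w ∂mu n a b) := by
    rw [← Real.enorm_of_nonneg (integral_nonneg_of_ae hnn)]
    simp [enorm_eq_nnnorm]
  refine Eq.trans ?_ e2.symm
  rw [ofReal_integral_eq_lintegral_ofReal hi hnn]
  refine lintegral_congr_ae ?_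
  filter_upwards [hball] with w hw
  rw [ENNReal.ofReal_mul (hg0 w hw)]

/-- The Berezin transform of a radial weight. -/
theorem exists_lintegral_wt_mul_bkernel (hn : 1 ≤ n) (ha : -1 < a) (hb : -(n : ℝ) < b) :
    ∃ C : ℝ, 0 < C ∧ ∀ s t : ℝ, -(n : ℝ) < b + s → -1 < a + t →
      ∀ z : EuclideanSpace ℂ (Fin n), ‖z‖ < 1 →
      ∫⁻ w, ENNReal.ofReal (wt s t w) * ENNReal.ofReal (bkernel n a b z w) ∂mu n a b =
        ∑' k : ℕ, ENNReal.ofReal (C * (kcoef n a b k ^ 2 * (k.factorial / Real.Gamma (k + n)) *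
          ProbabilityTheory.beta (k + (n + (b + s))) (a + t + 1) * (‖z‖ ^ 2) ^ k) *
            (kreal n a b (‖z‖ ^ 2))⁻¹) := by
  obtain ⟨C, hC, h⟩ := exists_lintegral_sqNorm_inner_mul_wt hn
  have hm := muConst_pos ha hb
  refine ⟨muConst n a b * C, by positivity, fun s t hs ht z hz => ?_⟩
  have hκ : Measurable (Function.uncurry fun z w : EuclideanSpace ℂ (Fin n) =>
      ENNReal.ofReal (bkernel n a b z w)) := (measurable_bkernel hn ha hb).ennreal_ofReal
  have hκz : Measurable fun w => ENNReal.ofReal (bkernel n a b z w) := hκ.of_uncurry_left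
  have hwt : Measurable fun w : EuclideanSpace ℂ (Fin n) => ENNReal.ofReal (wt s t w) := by fun_prop
  rw [lintegral_mu ha hb (by fun_prop)]
  have hk := one_le_kreal hn ha hb (by positivity) (sq_norm_lt_one hz)
  have hk0 : 0 ≤ (kreal n a b (‖z‖ ^ 2))⁻¹ := by positivity
  calc _ = ∫⁻ w, ENNReal.ofReal (muConst n a b * (kreal n a b (‖z‖ ^ 2))⁻¹) *
        (ENNReal.ofReal (sqNorm (kcoef n a b) (inner ℂ z w)) *
          ENNReal.ofReal (wt (b + s) (a + t) w)) ∂volBall n := by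
        refine lintegral_congr_ae ?_
        filter_upwards [ae_volBall, ae_ne_zero hn] with w hw hw0
        rw [← wt_mul_wt hw hw0, ENNReal.ofReal_mul (wt_nonneg hw), dens, bkernel,
          ENNReal.ofReal_mul (sqNorm_nonneg _ _), ENNReal.ofReal_mul hm.le]
        ring
    _ = _ := by
        rw [lintegral_const_mul' _ _ ENNReal.ofReal_ne_top,
          h _ (isDiskSeries_kcoef hn ha hb) z _ _ hz hs ht, ← ENNReal.tsum_mul_left]
        refine tsum_congr fun k => ?_
        rw [← ENNReal.ofReal_mul (by positivity)]
        congr 1; ring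

/-- The moments of `1 / 𝒦(|z|²)`. -/
theorem exists_le_lintegral_inv_kreal (hn : 1 ≤ n) (ha : -1 < a) (hb : -(n : ℝ) < b)
    (hc : -1 < c) (hd : -(n : ℝ) < d) (hp : 0 < p) :
    ∃ m : ℝ, 0 < m ∧ ∀ k : ℕ,
      ENNReal.ofReal (m * ProbabilityTheory.beta (k + (n + d)) (p * (n + a + 1) + c + 1)) ≤
        ∫⁻ z, ENNReal.ofReal ((‖z‖ ^ 2) ^ k * (kreal n a b (‖z‖ ^ 2))⁻¹ ^ p) ∂mu n c d := by
  obtain ⟨K, hK, h⟩ := exists_lintegral_wt hn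
  obtain ⟨M, hM, hk⟩ := exists_kreal_le hn ha hb
  have hm := muConst_pos hc hd
  have hn0 : (0 : ℝ) < n := by exact_mod_cast hn
  have hpa : 0 < p * (n + a + 1) := mul_pos hp (by linarith)
  refine ⟨muConst n c d * M⁻¹ ^ p * K, by positivity, fun k => ?_⟩
  have hk0 : (0 : ℝ) ≤ k := k.cast_nonneg
  have hkm := measurable_kreal n a b
  rw [lintegral_mu hc hd (by fun_prop), mul_assoc, ENNReal.ofReal_mul (by positivity),
    show (k : ℝ) + (n + d) = n + (d + k) by ring,
    show p * (n + a + 1) + c + 1 = (c + p * (n + a + 1)) + 1 by ring,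
    ← h _ _ (by linarith) (by linarith), ← lintegral_const_mul' _ _ ENNReal.ofReal_ne_top]
  refine lintegral_mono_ae ?_
  filter_upwards [ae_volBall, ae_ne_zero hn] with z hz hz0
  have hz' := sq_norm_lt_one hz
  have hz2 : 0 < 1 - ‖z‖ ^ 2 := by linarith
  have hz3 : 0 < ‖z‖ := norm_pos_iff.2 hz0
  have hk1 := one_le_kreal hn ha hb (by positivity) hz'
  have h1 : M⁻¹ * (1 - ‖z‖ ^ 2) ^ (n + a + 1) ≤ (kreal n a b (‖z‖ ^ 2))⁻¹ := by
    have := inv_anti₀ (by linarith) (hk _ (by positivity) hz')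
    rwa [mul_inv, ← Real.rpow_neg hz2.le, neg_neg] at this
  have h2 := Real.rpow_le_rpow (by positivity) h1 hp.le
  rw [Real.mul_rpow (by positivity) (by positivity), ← Real.rpow_mul hz2.le,
    mul_comm _ p] at h2
  rw [dens, ← ENNReal.ofReal_mul hm.le, ← ENNReal.ofReal_mul (by positivity),
    ← ENNReal.ofReal_mul (by positivity)]
  refine ENNReal.ofReal_le_ofReal ?_
  have e : wt (d + k) (c + p * (n + a + 1)) z =
      (‖z‖ ^ 2) ^ k * (1 - ‖z‖ ^ 2) ^ (p * (n + a + 1)) * wt d c z := by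
    have : (‖z‖ ^ 2) ^ k * (1 - ‖z‖ ^ 2) ^ (p * (n + a + 1)) = wt k (p * (n + a + 1)) z := by
      rw [wt, ← pow_mul, ← Real.rpow_natCast]; push_cast; rfl
    rw [this, wt_mul_wt hz hz0, add_comm d, add_comm c]
  have hw := wt_nonneg (s := d) (t := c) hz
  rw [e]
  calc _ = (muConst n c d * (‖z‖ ^ 2) ^ k * wt d c z) *
        (M⁻¹ ^ p * (1 - ‖z‖ ^ 2) ^ (p * (n + a + 1))) := by ring
    _ ≤ (muConst n c d * (‖z‖ ^ 2) ^ k * wt d c z) * (kreal n a b (‖z‖ ^ 2))⁻¹ ^ p :=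
        mul_le_mul_of_nonneg_left h2 (by positivity)
    _ = _ := by ring

theorem exists_lintegral_wt_rpow (hn : 1 ≤ n) (hc : -1 < c) (hd : -(n : ℝ) < d) (hp : 0 < p) :
    ∃ K : ℝ, 0 < K ∧ ∀ s t : ℝ, -(n : ℝ) < d + p * s → -1 < c + p * t →
      ∫⁻ w, ENNReal.ofReal (wt s t w) ^ p ∂mu n c d =
        ENNReal.ofReal (K * ProbabilityTheory.beta (n + (d + p * s)) (c + p * t + 1)) := by
  obtain ⟨K, hK, h⟩ := exists_lintegral_wt hn
  have hm := muConst_pos hc hd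
  refine ⟨muConst n c d * K, by positivity, fun s t hs ht => ?_⟩
  rw [lintegral_mu hc hd (by fun_prop), mul_assoc, ENNReal.ofReal_mul hm.le, ← h _ _ hs ht,
    ← lintegral_const_mul' _ _ ENNReal.ofReal_ne_top]
  refine lintegral_congr_ae ?_
  filter_upwards [ae_volBall, ae_ne_zero hn] with w hw hw0
  rw [ENNReal.ofReal_rpow_of_nonneg (wt_nonneg hw) hp.le, wt_rpow hw, dens, add_comm d, add_comm c,
    ← wt_mul_wt hw hw0, ENNReal.ofReal_mul (wt_nonneg hw)]
  ring

/-- Boundedness on radial weights, in terms of beta functions. -/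
theorem BerezinBounded.exists_beta_rpow_le (hn : 1 ≤ n) (ha : -1 < a) (hb : -(n : ℝ) < b)
    (hc : -1 < c) (hd : -(n : ℝ) < d) (hp : 0 < p) (H : BerezinBounded n a b c d p) :
    ∃ C : ℝ, ∀ s t : ℝ, -(n : ℝ) < b + s → -1 < a + t → -(n : ℝ) < d + p * s → -1 < c + p * t →
      ProbabilityTheory.beta (n + (b + s)) (a + t + 1) ^ p ≤
        C * ProbabilityTheory.beta (n + (d + p * s)) (c + p * t + 1) := by
  obtain ⟨C, hC⟩ := H.exists_lintegral_le hn ha hb hc hd hp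
  obtain ⟨K, hK, hKe⟩ := exists_lintegral_wt_rpow hn hc hd hp
  obtain ⟨m, hm, hme⟩ := exists_le_lintegral_inv_kreal hn ha hb hc hd hp
  obtain ⟨D, hD, hDe⟩ := exists_lintegral_wt_mul_bkernel hn ha hb
  have hn0 : (0 : ℝ) < n := by exact_mod_cast hn
  have hG := Real.Gamma_pos_of_pos hn0
  have hB0 : 0 < ProbabilityTheory.beta (n + d) (p * (n + a + 1) + c + 1) := by
    have : 0 < p * (n + a + 1) := mul_pos hp (by linarith)
    exact ProbabilityTheory.beta_pos (by linarith) (by linarith)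
  set L : ℝ := m * ProbabilityTheory.beta (n + d) (p * (n + a + 1) + c + 1) with hL
  have hL0 : 0 < L := by positivity
  have hLe := hme 0
  simp only [Nat.cast_zero, zero_add, pow_zero, one_mul] at hLe
  rw [← hL] at hLe
  set E : ℝ := D * (1 / Real.Gamma n) with hE
  have hE0 : 0 < E := by positivity
  refine ⟨C * K / (E ^ p * L), fun s t h1 h2 h3 h4 => ?_⟩
  have hβ1 := ProbabilityTheory.beta_pos (by linarith : 0 < n + (b + s))
    (by linarith : 0 < a + t + 1)
  have hβ2 := ProbabilityTheory.beta_pos (by linarith : 0 < n + (d + p * s))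
    (by linarith : 0 < c + p * t + 1)
  have hC' := hC (wt s t) (by fun_prop) (fun w hw => wt_nonneg hw)
    (by rw [hKe s t h3 h4]; exact ENNReal.ofReal_lt_top)
  rw [hKe s t h3 h4] at hC'
  set β₁ := ProbabilityTheory.beta (n + (b + s)) (a + t + 1) with hβ₁
  set β₂ := ProbabilityTheory.beta (n + (d + p * s)) (c + p * t + 1) with hβ₂
  have hlow : ENNReal.ofReal ((E * β₁) ^ p * L) ≤ ENNReal.ofReal (C * (K * β₂)) := by
    rw [ENNReal.ofReal_mul (NNReal.coe_nonneg C), ENNReal.ofReal_coe_nnreal]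
    refine le_trans ?_ hC'
    rw [ENNReal.ofReal_mul (by positivity)]
    refine (mul_le_mul_right hLe _).trans ?_
    rw [← lintegral_const_mul' _ _ ENNReal.ofReal_ne_top]
    refine lintegral_mono_ae ?_
    filter_upwards [(ae_mu_iff hn hc hd).2 ae_volBall] with z hz
    have hk1 := one_le_kreal hn ha hb (by positivity) (sq_norm_lt_one hz)
    rw [← ENNReal.ofReal_mul (by positivity), ← Real.mul_rpow (by positivity) (by positivity),
      ← ENNReal.ofReal_rpow_of_nonneg (by positivity) hp.le]
    refine ENNReal.rpow_le_rpow ?_ hp.le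
    rw [hDe s t h1 h2 z hz]
    -- Only the constant term of the series is kept; it already contains the singular beta factor.
    refine le_trans (le_of_eq ?_) (ENNReal.le_tsum 0)
    simp [kcoef_zero, hE, hβ₁]
    congr 2; ring
  rw [ENNReal.ofReal_le_ofReal_iff (by positivity), Real.mul_rpow hE0.le hβ1.le] at hlow
  rw [div_mul_eq_mul_div, le_div_iff₀ (by positivity)]
  linarith

/-- The strict inequality for `p = 1`: the weights `(1 - |w|²) ^ t` detect the divergence of
the harmonic series. -/
theorem not_berezinBounded_one (hn : 1 ≤ n) (ha : -1 < a) (hb : -(n : ℝ) < b)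
    (hd : -(n : ℝ) < d) : ¬ BerezinBounded n a b a d 1 := by
  intro H
  obtain ⟨C, hC⟩ := H.exists_lintegral_le hn ha hb ha hd one_pos
  obtain ⟨K, hK, hKe⟩ := exists_lintegral_wt_rpow hn ha hd one_pos
  obtain ⟨m, hm, hme⟩ := exists_le_lintegral_inv_kreal hn ha hb ha hd one_pos
  obtain ⟨D, hD, hDe⟩ := exists_lintegral_wt_mul_bkernel hn ha hb
  have hn0 : (0 : ℝ) < n := by exact_mod_cast hn
  -- `v k` collects the `k`-th coefficient and the lower bound for the `k`-th moment of `1/𝒦(|z|²)`.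
  -- Its exponent is exactly `-1`.
  let v : ℕ → ℝ := fun k => kcoef n a b k ^ 2 * (k.factorial / Real.Gamma (k + n)) *
    ProbabilityTheory.beta (k + (n + d)) (n + a + 1 + a + 1)
  have hv0 : ∀ k, 0 < v k := fun k => by
    have hk : (0 : ℝ) ≤ k := k.cast_nonneg
    have h1 := Real.Gamma_pos_of_pos (by linarith : 0 < k + (n : ℝ))
    have h2 := ProbabilityTheory.beta_pos (by linarith : 0 < k + (n + d))
      (by linarith : 0 < n + a + 1 + a + 1)
    have h3 := kcoef_pos hn ha hb k
    positivity
  have hvT := sq_kcoef_mul_beta_isTheta hn ha hb (t := n + a + 1 + a) hd (by linarith)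
  have hkm := measurable_kreal n a b
  -- The operator is tested on `(1-|w|²)^(y-a-1)`, and finitely many terms of the integrated series
  -- are kept.
  have hineq : ∀ (N : ℕ) (y : ℝ), 0 < y →
      ∑ k ∈ Finset.range N, D * m * v k * ProbabilityTheory.beta (k + (n + b)) y ≤
        C * K * ProbabilityTheory.beta (n + d) y := by
    intro N y hy
    have hβ := ProbabilityTheory.beta_pos (by linarith : 0 < n + d) hy
    have hβk : ∀ k : ℕ, 0 < ProbabilityTheory.beta (k + (n + b)) y := fun k => by
      have hk : (0 : ℝ) ≤ k := k.cast_nonneg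
      exact ProbabilityTheory.beta_pos (by linarith) hy
    have hKy := hKe 0 (y - a - 1) (by linarith) (by linarith)
    rw [mul_zero, add_zero, one_mul, show a + (y - a - 1) + 1 = y by ring] at hKy
    have hC' := hC (wt 0 (y - a - 1)) (by fun_prop) (fun w hw => wt_nonneg hw)
      (by rw [hKy]; exact ENNReal.ofReal_lt_top)
    rw [hKy] at hC'
    have hsum0 : 0 ≤ ∑ k ∈ Finset.range N, D * m * v k *
        ProbabilityTheory.beta (k + (n + b)) y := Finset.sum_nonneg fun k _ => by
      have := hv0 k; have := hβk k; positivity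
    rw [← ENNReal.ofReal_le_ofReal_iff (by positivity), mul_assoc,
      ENNReal.ofReal_mul (NNReal.coe_nonneg C), ENNReal.ofReal_coe_nnreal]
    refine le_trans ?_ hC'
    simp only [ENNReal.rpow_one]
    rw [ENNReal.ofReal_sum_of_nonneg fun k _ => by
      have := hv0 k; have := hβk k; positivity]
    let u : ℕ → ℝ := fun k => D * (kcoef n a b k ^ 2 * (k.factorial / Real.Gamma (k + n)) *
      ProbabilityTheory.beta (k + (n + b)) y)
    have hu0 : ∀ k, 0 ≤ u k := fun k => by
      have := hβk k
      have hk : (0 : ℝ) ≤ k := k.cast_nonneg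
      have h1 := Real.Gamma_pos_of_pos (by linarith : 0 < k + (n : ℝ))
      positivity
    calc _ ≤ ∑ k ∈ Finset.range N, ENNReal.ofReal (u k) *
          ∫⁻ z, ENNReal.ofReal ((‖z‖ ^ 2) ^ k * (kreal n a b (‖z‖ ^ 2))⁻¹ ^ (1 : ℝ)) ∂mu n a d := by
          refine Finset.sum_le_sum fun k _ => ?_
          refine le_trans (le_of_eq ?_) (mul_le_mul_right (hme k) _)
          rw [← ENNReal.ofReal_mul (hu0 k)]
          congr 1
          simp only [u, v, one_mul]
          ring
      _ ≤ ∑' k, ENNReal.ofReal (u k) *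
          ∫⁻ z, ENNReal.ofReal ((‖z‖ ^ 2) ^ k * (kreal n a b (‖z‖ ^ 2))⁻¹ ^ (1 : ℝ)) ∂mu n a d :=
          ENNReal.sum_le_tsum _
      _ = ∫⁻ z, ∑' k, ENNReal.ofReal (u k) *
          ENNReal.ofReal ((‖z‖ ^ 2) ^ k * (kreal n a b (‖z‖ ^ 2))⁻¹ ^ (1 : ℝ)) ∂mu n a d := by
          rw [lintegral_tsum fun k => by fun_prop]
          exact tsum_congr fun k => (lintegral_const_mul' _ _ ENNReal.ofReal_ne_top).symm
      _ = _ := by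
          refine lintegral_congr_ae ?_
          filter_upwards [(ae_mu_iff hn ha hd).2 ae_volBall] with z hz
          rw [hDe 0 (y - a - 1) (by linarith) (by linarith) z hz]
          refine tsum_congr fun k => ?_
          rw [← ENNReal.ofReal_mul (hu0 k)]
          congr 1
          rw [add_zero, show a + (y - a - 1) + 1 = y by ring, Real.rpow_one]
          simp only [u]
          ring
  -- Multiplying by `y` and letting `y → 0` replaces every beta factor by `1`, uniformly bounding
  -- the partial sums of `v`.
  have hbound : ∀ N : ℕ, ∑ k ∈ Finset.range N, D * m * v k ≤ C * K := by
    intro N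
    have t1 : Tendsto (fun y => ∑ k ∈ Finset.range N, D * m * v k *
        (y * ProbabilityTheory.beta (k + (n + b)) y)) (𝓝[>] 0)
        (𝓝 (∑ k ∈ Finset.range N, D * m * v k * 1)) :=
      tendsto_finsetSum _ fun k _ => (tendsto_mul_beta (by
        have hk : (0 : ℝ) ≤ k := k.cast_nonneg
        linarith)).const_mul _
    have t2 : Tendsto (fun y => C * K * (y * ProbabilityTheory.beta (n + d) y)) (𝓝[>] 0)
        (𝓝 (C * K * 1)) := (tendsto_mul_beta (by linarith)).const_mul _
    simp only [mul_one] at t1 t2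
    refine le_of_tendsto_of_tendsto t1 t2 ?_
    filter_upwards [self_mem_nhdsWithin] with y hy
    have hy0 : (0 : ℝ) < y := hy
    have := mul_le_mul_of_nonneg_left (hineq N y hy0) hy0.le
    rw [Finset.mul_sum] at this
    calc _ = ∑ k ∈ Finset.range N, y * (D * m * v k * ProbabilityTheory.beta (k + (n + b)) y) :=
          Finset.sum_congr rfl fun k _ => by ring
      _ ≤ _ := this
      _ = _ := by ring
  have hsumm : Summable fun k => D * m * v k :=
    summable_of_sum_range_le (fun k => by have := hv0 k; positivity) hbound
  have hv : Summable v := (summable_mul_left_iff (by positivity)).1 hsumm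
  obtain ⟨m', M', hm', -, hb'⟩ := exists_bounds_of_isTheta_top hv0 (fun k => by positivity) hvT
  have h1 : Summable fun k : ℕ => m' * (1 / ((k : ℝ) + 1)) := by
    refine Summable.of_nonneg_of_le (fun k => by positivity) (fun k => ?_) hv
    have := (hb' k).1
    rwa [show (n : ℝ) + 1 + 2 * a - (n + a + 1 + a) - 1 = -1 by ring, Real.rpow_neg_one,
      ← one_div] at this
  have h2 : Summable fun k : ℕ => 1 / (((k + 1 : ℕ) : ℝ)) := by
    simpa using (summable_mul_left_iff hm'.ne').1 h1
  exact Real.not_summable_one_div_natCast ((summable_nat_add_iff 1).1 h2)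

theorem BerezinBounded.necessary (hn : 1 ≤ n) (ha : -1 < a) (hb : -(n : ℝ) < b)
    (hc : -1 < c) (hd : -(n : ℝ) < d) (hp : 1 ≤ p) (H : BerezinBounded n a b c d p) :
    c + 1 < p * (a + 1) ∧ ((1 < p → d + n < p * (b + n)) ∧ (p = 1 → d ≤ b)) := by
  have hp0 : 0 < p := by linarith
  have hn0 : (0 : ℝ) < n := by exact_mod_cast hn
  obtain ⟨C, hC⟩ := H.exists_beta_rpow_le hn ha hb hc hd hp0
  have hfst : 0 ≤ c + 1 - p * (a + 1) → ¬ (1 < p ∨ 0 < c + 1 - p * (a + 1)) := by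
    intro h0 h1
    -- This fixed exponent keeps the first beta arguments away from `0`, while `t = y - a - 1`
    -- drives `a + t + 1 = y` to `0`.
    set s := |b| + |d| with hs
    have hs0 : 0 ≤ s := by positivity
    have hs1 : 0 ≤ b + s := by linarith [neg_abs_le b, abs_nonneg d]
    have hs2 : 0 ≤ d + p * s := by
      have : s ≤ p * s := le_mul_of_one_le_left hs0 hp
      linarith [neg_abs_le d, abs_nonneg b]
    refine not_forall_beta_rpow_le (x := n + (b + s)) (X := n + (d + p * s)) (C := C)
      (by linarith) (by linarith) h0 hp h1 fun y hy => ?_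
    have e : c + p * (y - a - 1) + 1 = c + 1 - p * (a + 1) + p * y := by ring
    have hpy : 0 < p * y := by positivity
    have := hC s (y - a - 1) (by linarith) (by linarith) (by linarith) (by linarith)
    rwa [e, show a + (y - a - 1) + 1 = y by ring] at this
  -- The same argument at the origin, with the two arguments of the beta function interchanged.
  have hsnd : 0 ≤ d + n - p * (b + n) → ¬ (1 < p ∨ 0 < d + n - p * (b + n)) := by
    intro h0 h1
    set t := |a| + |c| with ht
    have ht0 : 0 ≤ t := by positivity
    have ht1 : 0 ≤ a + t := by linarith [neg_abs_le a, abs_nonneg c]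
    have ht2 : 0 ≤ c + p * t := by
      have : t ≤ p * t := le_mul_of_one_le_left ht0 hp
      linarith [neg_abs_le c, abs_nonneg a]
    refine not_forall_beta_rpow_le (x := a + t + 1) (X := c + p * t + 1) (C := C)
      (by linarith) (by linarith) h0 hp h1 fun y hy => ?_
    have e : n + (d + p * (y - b - n)) = d + n - p * (b + n) + p * y := by ring
    have hpy : 0 < p * y := by positivity
    have := hC (y - b - n) t (by linarith) (by linarith) (by linarith) (by linarith)
    rwa [e, show n + (b + (y - b - n)) = y by ring, beta_comm y, beta_comm _ (c + p * t + 1)]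
      at this
  refine ⟨?_, fun hp1 => ?_, fun hp1 => ?_⟩
  · by_contra hcon
    -- For `p = 1` the beta inequality excludes only `c > a`; equality is left to the harmonic
    -- series.
    rcases hp.eq_or_lt with rfl | hp1
    · have hca : c = a := by
        by_contra hne
        have : 0 ≤ c + 1 - 1 * (a + 1) := by linarith
        refine hfst this (Or.inr (lt_of_le_of_ne this fun h => hne (by linarith)))
      subst hca
      exact not_berezinBounded_one hn hc hb hd H
    · exact hfst (by linarith) (Or.inl hp1)
  · by_contra hcon
    exact hsnd (by linarith) (Or.inl hp1)
  · subst hp1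
    by_contra hcon
    exact hsnd (by linarith) (Or.inr (by linarith))

end Necessity

end ModifiedBergman

theorem theorem3p2 (n : ℕ) (hn : 1 ≤ n) (a b c d : ℝ) (ha : -1 < a) (hc : -1 < c)
    (hb : -(n : ℝ) < b) (hd : -(n : ℝ) < d) (p : ℝ) (hp : 1 ≤ p) :
    ModifiedBergman.BerezinBounded n a b c d p ↔
      c + 1 < p * (a + 1) ∧
        ((1 < p → d + n < p * (b + n)) ∧ (p = 1 → d ≤ b)) := by
  refine ⟨fun H => H.necessary hn ha hb hc hd hp, fun ⟨h1, h2, h3⟩ => ?_⟩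
  exact ModifiedBergman.berezinBounded_of_lintegral_le hn ha hb hc hd (by linarith)
    (ModifiedBergman.exists_lintegral_bkernel_rpow_le hn ha hb hc hd hp h1 h2 h3)
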